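/- Let $n\ge 0$, $a,T>0$, and let $B(0,a)=\{x\in\mathbb R^n: |x|<a\}$. Let $$L=\frac{\partial}{\partial t}+\sum_{j=1}^n b_j(x,t)\frac{\partial}{\partial x_j}$$ be a complex vector field whose coefficients $b_j$ are smooth and complex-valued on $B(0,a)\times(-T,T)$. Let $F\subset B(0,a)$ be closed in $B(0,a)$ and assume that every $b_j$ vanishes on $F\times[0,T)$. Let $f$ be a complex-valued continuous function on $U^+=B(0,a)\times(0,T)$ such that $Lf=0$ in $U^+$ in the sense of distributions, and such that for every compact set $K\subset B(0,a)$ there exist $N\in\mathbb N$ and $C>0$ with $$\int_K|f(x,t)|\,dx\le \frac{C}{t^N}\qquad\text{for all sufficiently small } t>0.$$ Then the trace of $f$ at $t=0$ exists, that is, there is a distribution $bf\in\mathcal D'(B(0,a))$ with $f(\cdot,t)\to bf$ in $\mathcal D'(B(0,a))$ as $t\to0^+$. If $bf\in L^1(B(0,a))$, then for almost every $x\in F$ $$\lim_{t\to0^+}f(x,t)=bf(x),$$ and in fact $f(x,t)=bf(x)$ for all $t\in(0,T)$. -/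

import Mathlib

open Set Filter Topology MeasureTheory
open scoped ContDiff Distributions

namespace VectorFieldTrace

/-- The ball `B(0,a) = {x ∈ ℝⁿ : |x| < a}` (Euclidean norm), as an open set. -/
def ballOpens (n : ℕ) (a : ℝ) : TopologicalSpace.Opens (EuclideanSpace ℝ (Fin n)) :=
  ⟨Metric.ball 0 a, Metric.isOpen_ball⟩

/-- The half cylinder `U⁺ = B(0,a) × (0,T)`, as an open set of `ℝⁿ × ℝ`. -/
def halfCylinder (n : ℕ) (a T : ℝ) : TopologicalSpace.Opens (EuclideanSpace ℝ (Fin n) × ℝ) :=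
  ⟨Metric.ball 0 a ×ˢ Ioo 0 T, Metric.isOpen_ball.prod isOpen_Ioo⟩

/-- The formal transpose `Lᵗ Φ = -∂ₜ Φ - ∑ⱼ ∂_{xⱼ} (bⱼ Φ)` of the complex vector field
`L = ∂ₜ + ∑ⱼ bⱼ ∂_{xⱼ}`, applied to a function `Φ` on `ℝⁿ × ℝ`. -/
noncomputable def transposeField {n : ℕ} (b : Fin n → EuclideanSpace ℝ (Fin n) × ℝ → ℂ)
    (Φ : EuclideanSpace ℝ (Fin n) × ℝ → ℂ) (p : EuclideanSpace ℝ (Fin n) × ℝ) : ℂ :=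
  - fderiv ℝ Φ p (0, 1)
    - ∑ j, fderiv ℝ (fun q => b j q * Φ q) p (EuclideanSpace.single j 1, 0)

/-- `L f = 0` in `U⁺ = B(0,a) × (0,T)` in the sense of distributions, for a (continuous)
function `f`: `∫_{U⁺} f · Lᵗ Φ dx dt = 0` for every test function `Φ ∈ C_c^∞(U⁺)`. -/
def IsWeakSolution {n : ℕ} (b : Fin n → EuclideanSpace ℝ (Fin n) × ℝ → ℂ) (a T : ℝ)
    (f : EuclideanSpace ℝ (Fin n) × ℝ → ℂ) : Prop :=
  ∀ Φ : 𝓓(halfCylinder n a T, ℂ),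
    ∫ p in (halfCylinder n a T : Set (EuclideanSpace ℝ (Fin n) × ℝ)),
      f p * transposeField b Φ p = 0

/-- Tempered growth of the local `L¹` norms: for each compact `K ⊂ B(0,a)` there are `N` and
`C > 0` with `∫_K |f(x,t)| dx ≤ C / t ^ N` as `t → 0⁺`. -/
def HasTemperedL1Growth {n : ℕ} (a : ℝ) (f : EuclideanSpace ℝ (Fin n) × ℝ → ℂ) : Prop :=
  ∀ K : Set (EuclideanSpace ℝ (Fin n)), IsCompact K → K ⊆ Metric.ball 0 a →
    ∃ N : ℕ, ∃ C : ℝ, 0 < C ∧ ∀ᶠ t in 𝓝[>] (0 : ℝ), ∫ x in K, ‖f (x, t)‖ ≤ C / t ^ N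

/-- The distribution `bf` on `B(0,a)` is the trace of `f` at `t = 0`: the functions `f(·,t)`
converge to `bf` in `𝓓'(B(0,a))` as `t → 0⁺`. -/
def IsTrace {n : ℕ} {a : ℝ} (f : EuclideanSpace ℝ (Fin n) × ℝ → ℂ)
    (bf : 𝓓'(ballOpens n a, ℂ)) : Prop :=
  ∀ φ : 𝓓(ballOpens n a, ℝ),
    Tendsto (fun t : ℝ => ∫ x in Metric.ball 0 a, φ x • f (x, t)) (𝓝[>] 0) (𝓝 (bf φ))

/-- The distribution `u` on `B(0,a)` is (given by integration against) the function
`g ∈ L¹(B(0,a))`. -/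
def IsL1Function {n : ℕ} {a : ℝ} (u : 𝓓'(ballOpens n a, ℂ))
    (g : EuclideanSpace ℝ (Fin n) → ℂ) : Prop :=
  IntegrableOn g (Metric.ball 0 a) ∧
    ∀ φ : 𝓓(ballOpens n a, ℝ), u φ = ∫ x in Metric.ball 0 a, φ x • g x

end VectorFieldTrace

open VectorFieldTrace

/-!
# Traces of weak solutions of `L f = 0` and their restriction to the zero set of the coefficients

Write `D u = ∂ₜ u + ∑ⱼ ∂ⱼ (bⱼ u)`, so that `D = -Lᵗ`, and `⟨f, u⟩(t) = ∫ u(x, t) f(x, t) dx` for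
smooth `u` whose support in `x` is compact. The weak equation says that `⟨f, u⟩' = ⟨f, D u⟩` in
the sense of distributions on `(0, T)`, hence classically, both sides being continuous
(`SolvesOn.hasDerivAt_pairing`, by the du Bois-Reymond lemma). Therefore the `j`-th derivative of
`⟨f, φ⟩` is `⟨f, Dʲ φ⟩`, and all of them are `O(t ^ (-N))` with the same `N`. Taylor's formula of
order `N + 1` centred at any `τ ∈ (0, T)` has the kernel `(t - s) ^ N / N!` in its remainder, which
compensates this growth, so that the limit at `t = 0` exists and equals (`taylorTrace`)
`∑_{j ≤ N} (-τ)ʲ / j! ⟨f, Dʲ φ⟩(τ) - ∫₀^τ (-s)ᴺ / N! ⟨f, Dᴺ⁺¹ φ⟩(s) ds`.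
This expression involves finitely many derivatives of `φ`, whence a distribution `bf`.

For the restriction to `F`, let `S ⊆ F` be compact and apply this formula to cutoff functions `ψ_ε`
that are `1` near `S`, are supported in the `ε`-neighbourhood of `S` and have derivatives of order
`k` of size `ε ^ (-k)`. In `Dʲ φ = ∑_I c_I ∂_I φ` the coefficient `c_I` has at least `|I|` factors
that vanish on `S × (0, T)`, since every derivative that reaches `φ` comes with an undifferentiated
coefficient `bⱼ` (`IsTangentialOp.exists_evolve`). Hence `Dʲ ψ_ε` is bounded independently of `ε`
(`IsTangentialOp.exists_bound`). It tends to `0` off `S` by locality. On `S` it equals `Dʲ 1`, which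
for `j ≥ 1` vanishes at almost every point of `S`, because the derivatives of a function vanish at
the density points of its zero set (`ae_iterate_evolve_one_eq_zero`). By dominated convergence the
formula tends to `∫_S f(x, τ) dx` as `ε → 0`, while `bf(ψ_ε) → ∫_S g` if `bf` is the integrable
function `g`. So `f(·, τ)` and `g` have the same integral over every compact subset of `F`, for
every `τ ∈ (0, T)`, and thus agree almost everywhere on `F`; continuity of `f` in `t` makes the
exceptional set independent of `τ`.
-/

open Set Filter Topology MeasureTheory
open scoped ContDiff Distributions

namespace VectorFieldTrace

/-! ### The transposed operator -/

section Evolution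

variable {E : Type*} [NormedAddCommGroup E] [NormedSpace ℝ E] {ι : Type*} [Fintype ι]

/-- The operator `u ↦ ∂ₜ u + ∑ᵢ ∂_{eᵢ} (bᵢ u)`, that is minus the formal transpose of the vector
field `∂ₜ + ∑ᵢ bᵢ ∂_{eᵢ}`. -/
noncomputable def evolve (e : ι → E) (b : ι → E × ℝ → ℂ) (u : E × ℝ → ℂ) (p : E × ℝ) : ℂ :=
  fderiv ℝ u p (0, 1) + ∑ i, fderiv ℝ (fun q => b i q * u q) p (e i, 0)

variable {e : ι → E} {b : ι → E × ℝ → ℂ}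

theorem contDiff_fderiv_apply_const {F G : Type*} [NormedAddCommGroup F] [NormedSpace ℝ F]
    [NormedAddCommGroup G] [NormedSpace ℝ G]
    {u : F → G} (hu : ContDiff ℝ ∞ u) (v : F) : ContDiff ℝ ∞ (fun p => fderiv ℝ u p v) :=
  (hu.fderiv_right (m := ∞) (by simp)).clm_apply contDiff_const

theorem contDiff_evolve (hb : ∀ i, ContDiff ℝ ∞ (b i)) {u : E × ℝ → ℂ} (hu : ContDiff ℝ ∞ u) :
    ContDiff ℝ ∞ (evolve e b u) := by
  unfold evolve
  exact (contDiff_fderiv_apply_const hu _).add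
    (ContDiff.sum fun i _ => contDiff_fderiv_apply_const ((hb i).mul hu) _)

theorem contDiff_iterate_evolve (hb : ∀ i, ContDiff ℝ ∞ (b i)) {u : E × ℝ → ℂ}
    (hu : ContDiff ℝ ∞ u) (j : ℕ) : ContDiff ℝ ∞ ((evolve e b)^[j] u) := by
  induction j with
  | zero => exact hu
  | succ j ih => rw [Function.iterate_succ_apply']; exact contDiff_evolve hb ih

theorem evolve_congr {b' : ι → E × ℝ → ℂ} {u v : E × ℝ → ℂ} {p : E × ℝ}
    (h : u =ᶠ[𝓝 p] v) (hbb : ∀ i, b i =ᶠ[𝓝 p] b' i) : evolve e b u =ᶠ[𝓝 p] evolve e b' v := by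
  have h1 : ∀ i, fderiv ℝ (fun q => b i q * u q) =ᶠ[𝓝 p] fderiv ℝ (fun q => b' i q * v q) :=
    fun i => EventuallyEq.fderiv (𝕜 := ℝ) ((hbb i).mul h)
  filter_upwards [EventuallyEq.fderiv (𝕜 := ℝ) h, eventually_all.2 h1] with q hq hq'
  simp only [evolve, hq, hq']

theorem iterate_evolve_congr {u v : E × ℝ → ℂ} {p : E × ℝ}
    (h : u =ᶠ[𝓝 p] v) (j : ℕ) : (evolve e b)^[j] u =ᶠ[𝓝 p] (evolve e b)^[j] v := by
  induction j with
  | zero => exact h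
  | succ j ih =>
    rw [Function.iterate_succ_apply', Function.iterate_succ_apply']
    exact evolve_congr ih fun i => .rfl

theorem evolve_zero : evolve e b (0 : E × ℝ → ℂ) = 0 := by
  ext p
  have : fderiv ℝ (0 : E × ℝ → ℂ) p = 0 := by rw [fderiv_zero]; rfl
  have h2 : fderiv ℝ (fun _ : E × ℝ => (0 : ℂ)) p = 0 := by rw [fderiv_fun_const]; rfl
  simp [evolve, this, h2]

theorem iterate_evolve_zero (j : ℕ) : (evolve e b)^[j] (0 : E × ℝ → ℂ) = 0 :=
  Function.iterate_fixed evolve_zero j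

/-- Locality: the evolution operator preserves vanishing outside a closed cylinder. -/
theorem iterate_evolve_eq_zero {K : Set E} (hK : IsClosed K) {u : E × ℝ → ℂ}
    (hu : ∀ p : E × ℝ, p.1 ∉ K → u p = 0) (j : ℕ) {p : E × ℝ} (hp : p.1 ∉ K) :
    (evolve e b)^[j] u p = 0 := by
  have h : u =ᶠ[𝓝 p] 0 := by
    filter_upwards [(hK.isOpen_compl.preimage continuous_fst).mem_nhds hp] with q hq using hu q hq
  simpa [iterate_evolve_zero] using (iterate_evolve_congr (e := e) (b := b) h j).eq_of_nhds

theorem evolve_mul_time (hb : ∀ i, Differentiable ℝ (b i)) {u : E × ℝ → ℂ}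
    (hu : Differentiable ℝ u) {η : ℝ → ℝ} (hη : Differentiable ℝ η) (p : E × ℝ) :
    evolve e b (fun q => (η q.2 : ℂ) * u q) p
      = ((deriv η p.2 : ℝ) : ℂ) * u p + (η p.2 : ℂ) * evolve e b u p := by
  have hη' : HasFDerivAt (fun q : E × ℝ => (η q.2 : ℂ))
      (Complex.ofRealCLM ∘L ((ContinuousLinearMap.toSpanSingleton ℝ (deriv η p.2)) ∘L
        ContinuousLinearMap.snd ℝ E ℝ)) p :=
    Complex.ofRealCLM.hasFDerivAt.comp p
      ((hη p.2).hasDerivAt.hasFDerivAt.comp p hasFDerivAt_snd)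
  have h1 := hη'.mul (hu p).hasFDerivAt
  have h2 : ∀ i, fderiv ℝ (fun q => b i q * ((η q.2 : ℂ) * u q)) p (e i, 0)
      = (η p.2 : ℂ) * fderiv ℝ (fun q => b i q * u q) p (e i, 0) := by
    intro i
    have h3 := hη'.mul ((hb i p).mul (hu p)).hasFDerivAt
    have : (fun q => b i q * ((η q.2 : ℂ) * u q)) = fun q : E × ℝ => (η q.2 : ℂ) * (b i q * u q) := by
      ext q; ring
    rw [this]
    erw [h3.fderiv]
    simp
    left; rfl
  simp only [evolve, h2]
  erw [h1.fderiv]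
  simp [Finset.mul_sum, mul_add]
  ring

end Evolution

/-! ### Operators whose coefficients vanish on a set -/

section Flat

variable {E : Type*} [NormedAddCommGroup E] [NormedSpace ℝ E] {ι : Type*}

/-- The iterated partial derivative `∂_{e i₁} ⋯ ∂_{e iₖ} φ` along the list `[i₁, …, iₖ]`. -/
noncomputable def iteratedPartial (e : ι → E) (φ : E → ℝ) : List ι → E → ℝ
  | [] => φ
  | i :: I => fun x => fderiv ℝ (iteratedPartial e φ I) x (e i)

theorem contDiff_iteratedPartial (e : ι → E) {φ : E → ℝ} (hφ : ContDiff ℝ ∞ φ) (I : List ι) :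
    ContDiff ℝ ∞ (iteratedPartial e φ I) := by
  induction I with
  | nil => exact hφ
  | cons i I ih => exact contDiff_fderiv_apply_const ih _

theorem iteratedPartial_eq_iteratedFDeriv (e : ι → E) {φ : E → ℝ} (hφ : ContDiff ℝ ∞ φ)
    (I : List ι) (x : E) :
    iteratedPartial e φ I x = iteratedFDeriv ℝ I.length φ x (fun k => e (I.get k)) := by
  induction I generalizing x with
  | nil => simp [iteratedPartial]
  | cons i I ih =>
    have h : iteratedPartial e φ I = fun y => iteratedFDeriv ℝ I.length φ y
        (fun k => e (I.get k)) := funext ih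
    have hd : DifferentiableAt ℝ (iteratedFDeriv ℝ I.length φ) x :=
      (hφ.differentiable_iteratedFDeriv (by exact_mod_cast WithTop.coe_lt_top _)) x
    change fderiv ℝ (iteratedPartial e φ I) x (e i) = _
    rw [h, fderiv_continuousMultilinear_apply_const_apply hd]
    exact (iteratedFDeriv_succ_apply_left (𝕜 := ℝ) (n := I.length) (f := φ) (x := x)
      (fun k => e ((i :: I).get k))).symm

theorem abs_iteratedPartial_le (e : ι → E) {φ : E → ℝ} (hφ : ContDiff ℝ ∞ φ)
    (I : List ι) (x : E) :
    |iteratedPartial e φ I x| ≤ ‖iteratedFDeriv ℝ I.length φ x‖ * (I.map fun i => ‖e i‖).prod := by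
  rw [iteratedPartial_eq_iteratedFDeriv e hφ, ← Real.norm_eq_abs]
  refine ((iteratedFDeriv ℝ I.length φ x).le_opNorm _).trans_eq ?_
  congr 1
  rw [← List.prod_ofFn]
  congr 1
  apply List.ext_get <;> simp

/-- `VanishesToOrder S T k c` says that `c` is a finite sum of products of smooth functions on
`E × ℝ`, each product having `k` factors that vanish on `S × (0, T)`. -/
inductive VanishesToOrder (S : Set E) (T : ℝ) : ℕ → (E × ℝ → ℂ) → Prop
  | of_contDiff {c : E × ℝ → ℂ} : ContDiff ℝ ∞ c → VanishesToOrder S T 0 c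
  | mul {k : ℕ} {β c : E × ℝ → ℂ} : ContDiff ℝ ∞ β → (∀ x ∈ S, ∀ t ∈ Ioo 0 T, β (x, t) = 0) →
      VanishesToOrder S T k c → VanishesToOrder S T (k + 1) (β * c)
  | add {k : ℕ} {c d : E × ℝ → ℂ} : VanishesToOrder S T k c → VanishesToOrder S T k d →
      VanishesToOrder S T k (c + d)

namespace VanishesToOrder

variable {S : Set E} {T : ℝ} {k : ℕ} {c : E × ℝ → ℂ}

theorem contDiff (h : VanishesToOrder S T k c) : ContDiff ℝ ∞ c := by
  induction h with
  | of_contDiff h => exact h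
  | mul h _ _ ih => exact h.mul ih
  | add _ _ ih ih' => exact ih.add ih'

theorem smooth_mul {g : E × ℝ → ℂ} (hg : ContDiff ℝ ∞ g) (h : VanishesToOrder S T k c) :
    VanishesToOrder S T k (g * c) := by
  induction h with
  | of_contDiff h => exact .of_contDiff (hg.mul h)
  | mul h h0 _ ih => rw [mul_left_comm]; exact .mul h h0 ih
  | add _ _ ih ih' => rw [mul_add]; exact ih.add ih'

theorem fderiv_mul_apply {β c : E × ℝ → ℂ} (hβ : ContDiff ℝ ∞ β) (hc : ContDiff ℝ ∞ c)
    (v : E × ℝ) : (fun p => fderiv ℝ (β * c) p v)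
      = (fun p => fderiv ℝ β p v) * c + β * fun p => fderiv ℝ c p v := by
  ext p
  rw [fderiv_mul (hβ.differentiable (by simp) p) (hc.differentiable (by simp) p)]
  simp
  ring

theorem fderiv_add_apply {β c : E × ℝ → ℂ} (hβ : ContDiff ℝ ∞ β) (hc : ContDiff ℝ ∞ c)
    (v : E × ℝ) : (fun p => fderiv ℝ (β + c) p v)
      = (fun p => fderiv ℝ β p v) + fun p => fderiv ℝ c p v := by
  ext p
  rw [fderiv_add (hβ.differentiable (by simp) p) (hc.differentiable (by simp) p)]
  simp

theorem fderiv_apply (h : VanishesToOrder S T k c) (v : E × ℝ) :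
    VanishesToOrder S T (k - 1) (fun p => fderiv ℝ c p v) := by
  induction h with
  | of_contDiff h => exact .of_contDiff (contDiff_fderiv_apply_const h v)
  | @mul k β c h h0 hc ih =>
    rw [fderiv_mul_apply h hc.contDiff]
    refine .add (hc.smooth_mul (contDiff_fderiv_apply_const h v)) ?_
    rcases k with _ | k
    · exact ih.smooth_mul h
    · exact .mul h h0 ih
  | add hc hd ih ih' => rw [fderiv_add_apply hc.contDiff hd.contDiff]; exact ih.add ih'

/-- Differentiation in `t` is tangent to `S × (0, T)`, so it does not lower the order of
vanishing. -/
theorem fderiv_time (h : VanishesToOrder S T k c) :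
    VanishesToOrder S T k (fun p => fderiv ℝ c p (0, 1)) := by
  induction h with
  | of_contDiff h => exact .of_contDiff (contDiff_fderiv_apply_const h _)
  | @mul k β c h h0 hc ih =>
    rw [fderiv_mul_apply h hc.contDiff]
    refine .add (.mul (contDiff_fderiv_apply_const h _) ?_ hc) (.mul h h0 ih)
    intro x hx t ht
    have h1 : HasDerivAt (fun s : ℝ => β (x, s)) (fderiv ℝ β (x, t) (0, 1)) t :=
      ((h.differentiable (by simp) (x, t)).hasFDerivAt).comp_hasDerivAt t
        ((hasDerivAt_const t x).prodMk (hasDerivAt_id t))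
    have h2 : (fun s : ℝ => β (x, s)) =ᶠ[𝓝 t] fun _ => 0 := by
      filter_upwards [Ioo_mem_nhds ht.1 ht.2] with s hs using h0 x hx s hs
    exact h1.unique ((hasDerivAt_const t (0 : ℂ)).congr_of_eventuallyEq h2)
  | add hc hd ih ih' => rw [fderiv_add_apply hc.contDiff hd.contDiff]; exact ih.add ih'

/-- A function vanishing to order `k` on `S × (0, T)` is locally uniformly `O(dist(x, S) ^ k)`. -/
theorem exists_bound [FiniteDimensional ℝ E] (h : VanishesToOrder S T k c) (R : ℝ) :
    ∃ C, 0 ≤ C ∧ ∀ x y : E, ‖x‖ ≤ R → ‖y‖ ≤ R → y ∈ S → ∀ t ∈ Ioo 0 T,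
      ‖c (x, t)‖ ≤ C * ‖x - y‖ ^ k := by
  have : ProperSpace E := FiniteDimensional.proper_real E
  have hcpt : IsCompact (Metric.closedBall (0 : E) R ×ˢ Icc 0 T) :=
    (isCompact_closedBall _ _).prod isCompact_Icc
  induction h with
  | @of_contDiff c h =>
    obtain ⟨C, hC⟩ := hcpt.exists_bound_of_continuousOn h.continuous.continuousOn
    refine ⟨max C 0, le_max_right _ _, fun x y hx _ _ t ht => ?_⟩
    simpa using Or.inl (hC (x, t) ⟨by simpa using hx, ht.1.le, ht.2.le⟩)
  | @mul k β c h h0 hc ih =>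
    obtain ⟨C, hC0, hC⟩ := ih
    obtain ⟨M, hM⟩ := hcpt.exists_bound_of_continuousOn
      (h.continuous_fderiv (by simp)).continuousOn
    have hM0 : ∀ x y : E, ‖x‖ ≤ R → ‖y‖ ≤ R → ∀ t ∈ Ioo 0 T,
        ‖β (x, t) - β (y, t)‖ ≤ max M 0 * ‖x - y‖ := by
      intro x y hx hy t ht
      have := Convex.norm_image_sub_le_of_norm_fderiv_le (𝕜 := ℝ) (f := β) (C := max M 0)
        (s := Metric.closedBall (0 : E) R ×ˢ Icc 0 T) (x := (y, t)) (y := (x, t))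
        (fun p _ => h.differentiable (by simp) p) (fun p hp => (hM p hp).trans (le_max_left _ _))
        ((convex_closedBall _ _).prod (convex_Icc _ _))
        ⟨by simpa using hy, ht.1.le, ht.2.le⟩ ⟨by simpa using hx, ht.1.le, ht.2.le⟩
      simpa [Prod.norm_def] using this
    refine ⟨max M 0 * C, by positivity, fun x y hx hy hyS t ht => ?_⟩
    have h1 := hM0 x y hx hy t ht
    rw [h0 y hyS t ht, sub_zero] at h1
    calc ‖(β * c) (x, t)‖ = ‖β (x, t)‖ * ‖c (x, t)‖ := norm_mul _ _
      _ ≤ (max M 0 * ‖x - y‖) * (C * ‖x - y‖ ^ k) :=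
        mul_le_mul h1 (hC x y hx hy hyS t ht) (norm_nonneg _) (by positivity)
      _ = max M 0 * C * ‖x - y‖ ^ (k + 1) := by ring
  | add hc hd ih ih' =>
    obtain ⟨C, hC0, hC⟩ := ih
    obtain ⟨C', hC0', hC'⟩ := ih'
    refine ⟨C + C', by positivity, fun x y hx hy hyS t ht => ?_⟩
    rw [add_mul]
    exact (norm_add_le _ _).trans (add_le_add (hC x y hx hy hyS t ht) (hC' x y hx hy hyS t ht))

end VanishesToOrder

/-- The linear differential operators `φ ↦ ∑_I c_I ∂_I φ` from functions on `E` to functions on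
`E × ℝ` whose coefficient `c_I` vanishes to order `|I|` on `S × (0, T)`. -/
inductive IsTangentialOp (e : ι → E) (S : Set E) (T : ℝ) : ((E → ℝ) → E × ℝ → ℂ) → Prop
  | term (I : List ι) {c : E × ℝ → ℂ} : VanishesToOrder S T I.length c →
      IsTangentialOp e S T (fun φ p => c p * (iteratedPartial e φ I p.1 : ℂ))
  | add {P Q : (E → ℝ) → E × ℝ → ℂ} : IsTangentialOp e S T P → IsTangentialOp e S T Q →
      IsTangentialOp e S T (P + Q)

namespace IsTangentialOp

variable {e : ι → E} {S : Set E} {T : ℝ}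

theorem zero : IsTangentialOp e S T 0 := by
  have := term (e := e) (S := S) (T := T) [] (c := 0) (.of_contDiff contDiff_const)
  convert this using 1
  ext
  simp

theorem sum {κ : Type*} (s : Finset κ) (P : κ → (E → ℝ) → E × ℝ → ℂ)
    (h : ∀ i ∈ s, IsTangentialOp e S T (P i)) : IsTangentialOp e S T (∑ i ∈ s, P i) :=
  Finset.sum_induction P _ (fun _ _ => add) zero h

theorem hasFDerivAt_partial_fst {φ : E → ℝ} (hφ : ContDiff ℝ ∞ φ) (I : List ι) (p : E × ℝ) :
    HasFDerivAt (fun q : E × ℝ => (iteratedPartial e φ I q.1 : ℂ))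
      (Complex.ofRealCLM ∘L (fderiv ℝ (iteratedPartial e φ I) p.1 ∘L
        ContinuousLinearMap.fst ℝ E ℝ)) p :=
  Complex.ofRealCLM.hasFDerivAt.comp p
    (((contDiff_iteratedPartial e hφ I).differentiable (by simp) p.1).hasFDerivAt.comp p
      hasFDerivAt_fst)

theorem contDiff {P : (E → ℝ) → E × ℝ → ℂ} (h : IsTangentialOp e S T P) {φ : E → ℝ}
    (hφ : ContDiff ℝ ∞ φ) : ContDiff ℝ ∞ (P φ) := by
  induction h with
  | term I hc =>
    exact hc.contDiff.mul (Complex.ofRealCLM.contDiff.comp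
      ((contDiff_iteratedPartial e hφ I).comp contDiff_fst))
  | add _ _ ih ih' => exact ih.add ih'

theorem fderiv_term {φ : E → ℝ} (hφ : ContDiff ℝ ∞ φ) (I : List ι) {c : E × ℝ → ℂ}
    (hc : ContDiff ℝ ∞ c) (p v : E × ℝ) :
    fderiv ℝ (fun q : E × ℝ => c q * (iteratedPartial e φ I q.1 : ℂ)) p v
      = fderiv ℝ c p v * (iteratedPartial e φ I p.1 : ℂ)
        + c p * (fderiv ℝ (iteratedPartial e φ I) p.1 v.1 : ℝ) := by
  have h := (hc.differentiable (by simp) p).hasFDerivAt.mul (hasFDerivAt_partial_fst (e := e) hφ I p)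
  erw [h.fderiv]
  simp
  ring

/-- Tangential operators are stable under `u ↦ ∂ₜ u + ∑ᵢ ∂_{eᵢ} (bᵢ u)` when all the `bᵢ` vanish on
`S × (0, T)`: a derivative falling on `φ` is paid for by the factor `bᵢ`. -/
theorem exists_evolve [Fintype ι] {b : ι → E × ℝ → ℂ} (hb : ∀ i, ContDiff ℝ ∞ (b i))
    (hbS : ∀ i, ∀ x ∈ S, ∀ t ∈ Ioo 0 T, b i (x, t) = 0)
    {P : (E → ℝ) → E × ℝ → ℂ} (h : IsTangentialOp e S T P) :
    ∃ Q, IsTangentialOp e S T Q ∧ ∀ φ : E → ℝ, ContDiff ℝ ∞ φ → evolve e b (P φ) = Q φ := by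
  induction h with
  | @term I c hc =>
    refine ⟨(fun φ p => fderiv ℝ c p (0, 1) * (iteratedPartial e φ I p.1 : ℂ))
      + ∑ i, ((fun φ p => fderiv ℝ (b i * c) p (e i, 0) * (iteratedPartial e φ I p.1 : ℂ))
        + fun φ p => (b i * c) p * (iteratedPartial e φ (i :: I) p.1 : ℂ)), ?_, ?_⟩
    · refine .add (.term I hc.fderiv_time) (.sum _ _ fun i _ => .add (.term I ?_) ?_)
      · exact (VanishesToOrder.mul (hb i) (hbS i) hc).fderiv_apply _
      · exact .term (i :: I) (VanishesToOrder.mul (hb i) (hbS i) hc)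
    · intro φ hφ
      ext p
      have h1 : ∀ i, fderiv ℝ (fun q => b i q * (c q * (iteratedPartial e φ I q.1 : ℂ))) p (e i, 0)
          = fderiv ℝ (b i * c) p (e i, 0) * (iteratedPartial e φ I p.1 : ℂ)
            + (b i * c) p * (iteratedPartial e φ (i :: I) p.1 : ℂ) := by
        intro i
        have := fderiv_term (e := e) hφ I ((hb i).mul hc.contDiff) p (e i, 0)
        simp only [Pi.mul_apply, mul_assoc] at this ⊢
        exact this
      simp only [evolve, h1, fderiv_term (e := e) hφ I hc.contDiff]
      simp [Finset.sum_apply]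
  | @add P P' hP hP' ih ih' =>
    obtain ⟨Q, hQ, h⟩ := ih
    obtain ⟨Q', hQ', h'⟩ := ih'
    refine ⟨Q + Q', hQ.add hQ', fun φ hφ => ?_⟩
    ext p
    rw [Pi.add_apply, Pi.add_apply, ← h φ hφ, ← h' φ hφ]
    have d : ∀ v, fderiv ℝ (P φ + P' φ) p v = fderiv ℝ (P φ) p v + fderiv ℝ (P' φ) p v := fun v =>
      congrFun (VanishesToOrder.fderiv_add_apply (hP.contDiff hφ) (hP'.contDiff hφ) v) p
    have d' : ∀ i v, fderiv ℝ (fun q => b i q * (P φ q + P' φ q)) p v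
        = fderiv ℝ (fun q => b i q * P φ q) p v + fderiv ℝ (fun q => b i q * P' φ q) p v := by
      intro i v
      have := congrFun (VanishesToOrder.fderiv_add_apply ((hb i).mul (hP.contDiff hφ))
        ((hb i).mul (hP'.contDiff hφ)) v) p
      rw [Pi.add_apply] at this
      rw [← this]
      congr 2
      ext q
      simp [mul_add]
    simp only [Pi.add_apply, evolve]
    rw [Finset.sum_congr rfl fun i _ => d' i (e i, 0), d, Finset.sum_add_distrib]
    ring

theorem exists_iterate_evolve [Fintype ι] {b : ι → E × ℝ → ℂ} (hb : ∀ i, ContDiff ℝ ∞ (b i))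
    (hbS : ∀ i, ∀ x ∈ S, ∀ t ∈ Ioo 0 T, b i (x, t) = 0) (j : ℕ) :
    ∃ Q, IsTangentialOp e S T Q ∧ ∀ φ : E → ℝ, ContDiff ℝ ∞ φ →
      (evolve e b)^[j] (fun p => (φ p.1 : ℂ)) = Q φ := by
  induction j with
  | zero =>
    refine ⟨_, .term [] (c := 1) (.of_contDiff contDiff_const), fun φ _ => ?_⟩
    ext p
    simp [iteratedPartial]
  | succ j ih =>
    obtain ⟨P, hP, h⟩ := ih
    obtain ⟨Q, hQ, h'⟩ := hP.exists_evolve hb hbS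
    exact ⟨Q, hQ, fun φ hφ => by rw [Function.iterate_succ_apply', h φ hφ, h' φ hφ]⟩

/-- A tangential operator maps functions concentrated in the `ε`-neighbourhood of `S`, and whose
derivatives satisfy `|∂_I φ| ≤ A_I ε ^ (-|I|)`, to functions bounded independently of `ε`. -/
theorem exists_bound [FiniteDimensional ℝ E] {P : (E → ℝ) → E × ℝ → ℂ}
    (h : IsTangentialOp e S T P) (R : ℝ) (A : List ι → ℝ) :
    ∃ C, ∀ (φ : E → ℝ) (ε : ℝ), 0 < ε → (∀ I x, |iteratedPartial e φ I x| ≤ A I * (ε⁻¹) ^ I.length) →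
      ∀ x y : E, ‖x‖ ≤ R → ‖y‖ ≤ R → y ∈ S → ‖x - y‖ ≤ ε → ∀ t ∈ Ioo 0 T,
        ‖P φ (x, t)‖ ≤ C := by
  induction h with
  | @term I c hc =>
    obtain ⟨C, hC0, hC⟩ := hc.exists_bound R
    refine ⟨C * A I, fun φ ε hε hφ x y hx hy hyS hxy t ht => ?_⟩
    rw [norm_mul, Complex.norm_real, Real.norm_eq_abs]
    calc ‖c (x, t)‖ * |iteratedPartial e φ I x|
        ≤ (C * ε ^ I.length) * (A I * (ε⁻¹) ^ I.length) := by
          refine mul_le_mul ((hC x y hx hy hyS t ht).trans ?_) (hφ I x) (abs_nonneg _)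
            (by positivity)
          gcongr
      _ = C * A I * (ε * ε⁻¹) ^ I.length := by rw [mul_pow]; ring
      _ = C * A I := by rw [mul_inv_cancel₀ hε.ne', one_pow, mul_one]
  | add _ _ ih ih' =>
    obtain ⟨C, hC⟩ := ih
    obtain ⟨C', hC'⟩ := ih'
    exact ⟨C + C', fun φ ε hε hφ x y hx hy hyS hxy t ht => (norm_add_le _ _).trans
      (add_le_add (hC φ ε hε hφ x y hx hy hyS hxy t ht) (hC' φ ε hε hφ x y hx hy hyS hxy t ht))⟩

/-- A tangential operator has finite order: its values on a compact set are bounded by finitely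
many derivatives of the argument. -/
theorem exists_bound_of_isCompact {P : (E → ℝ) → E × ℝ → ℂ}
    (h : IsTangentialOp e S T P) {K : Set (E × ℝ)} (hK : IsCompact K) :
    ∃ (C : ℝ) (m : ℕ), 0 ≤ C ∧ ∀ φ : E → ℝ, ContDiff ℝ ∞ φ → ∀ M : ℝ,
      (∀ k ≤ m, ∀ x, ‖iteratedFDeriv ℝ k φ x‖ ≤ M) → ∀ p ∈ K, ‖P φ p‖ ≤ C * M := by
  induction h with
  | @term I c hc =>
    obtain ⟨C, hC⟩ := hK.exists_bound_of_continuousOn hc.contDiff.continuous.continuousOn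
    have hprod : 0 ≤ (I.map fun i => ‖e i‖).prod :=
      List.prod_nonneg (by simp only [List.mem_map]; rintro _ ⟨i, -, rfl⟩; exact norm_nonneg _)
    refine ⟨max C 0 * (I.map fun i => ‖e i‖).prod, I.length, by positivity, ?_⟩
    intro φ hφ M hM p hp
    rw [norm_mul, Complex.norm_real, Real.norm_eq_abs]
    calc ‖c p‖ * |iteratedPartial e φ I p.1|
        ≤ max C 0 * (M * (I.map fun i => ‖e i‖).prod) := by
          refine mul_le_mul ((hC p hp).trans (le_max_left _ _))
            ((abs_iteratedPartial_le e hφ I p.1).trans ?_) (abs_nonneg _) (by positivity)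
          gcongr
          exact hM _ le_rfl _
      _ = _ := by ring
  | add _ _ ih ih' =>
    obtain ⟨C, m, hC0, hC⟩ := ih
    obtain ⟨C', m', hC0', hC'⟩ := ih'
    refine ⟨C + C', max m m', by positivity, fun φ hφ M hM p hp => ?_⟩
    rw [add_mul]
    exact (norm_add_le _ _).trans (add_le_add
      (hC φ hφ M (fun k hk => hM k (hk.trans (le_max_left _ _))) p hp)
      (hC' φ hφ M (fun k hk => hM k (hk.trans (le_max_right _ _))) p hp))

end IsTangentialOp

end Flat

section AlmostEverywhere

variable {E : Type*} [NormedAddCommGroup E] [NormedSpace ℝ E] [FiniteDimensional ℝ E]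
  [MeasurableSpace E] [BorelSpace E] {ι : Type*} [Fintype ι]

/-- Derivatives within a set are unique at almost all of its points, namely at its Lebesgue density
points. -/
theorem ae_uniqueDiffWithinAt (μ : Measure E) [μ.IsAddHaarMeasure] {S : Set E}
    (hS : MeasurableSet S) : ∀ᵐ x ∂μ.restrict S, UniqueDiffWithinAt ℝ S x := by
  filter_upwards [Besicovitch.ae_tendsto_measure_inter_div μ S, ae_restrict_mem hS] with x hx hxS
  refine ⟨?_, subset_closure hxS⟩
  suffices h : tangentConeAt ℝ S x = univ by rw [h]; simp
  refine eq_univ_of_forall fun z => ?_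
  have key : ∀ n : ℕ, ∃ r : ℝ, ∃ y : E, 0 < r ∧ r < 1 / (n + 1 : ℝ) ∧
      ‖y - z‖ ≤ 1 / (n + 1 : ℝ) ∧ x + r • y ∈ S := by
    intro n
    have hn : (0 : ℝ) < 1 / (n + 1 : ℝ) := by positivity
    have h1 := Measure.eventually_nonempty_inter_smul_of_density_one μ S x hx
      (Metric.closedBall z (1 / (n + 1 : ℝ))) measurableSet_closedBall
      (Metric.measure_closedBall_pos μ z hn).ne'
    obtain ⟨r, ⟨w, hwS, hw⟩, hr⟩ := (h1.and (Ioo_mem_nhdsGT hn)).exists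
    obtain ⟨_, rfl, _, ⟨y, hy, rfl⟩, rfl⟩ := hw
    exact ⟨r, y, hr.1, hr.2, by simpa [dist_eq_norm] using hy, hwS⟩
  choose r y hr0 hr hy hS' using key
  have hlim : Tendsto (fun n : ℕ => 1 / (n + 1 : ℝ)) atTop (𝓝 0) :=
    tendsto_one_div_add_atTop_nhds_zero_nat
  have hr' : Tendsto r atTop (𝓝 0) := squeeze_zero (fun n => (hr0 n).le) (fun n => (hr n).le) hlim
  have hy' : Tendsto y atTop (𝓝 z) :=
    tendsto_iff_norm_sub_tendsto_zero.2 (squeeze_zero (fun n => norm_nonneg _) hy hlim)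
  refine mem_tangentConeAt_of_seq atTop (fun n => (r n)⁻¹) (fun n => r n • y n) ?_
    (Eventually.of_forall hS') ?_
  · simpa using hr'.smul hy'
  · simpa [smul_smul, inv_mul_cancel₀ (hr0 _).ne'] using hy'

/-- At almost every point of a set where a family of functions vanishes, so do their derivatives.
The exceptional set, the points which are not density points, is the same for the whole family. -/
theorem ae_fderiv_eq_zero (μ : Measure E) [μ.IsAddHaarMeasure] {S : Set E} (hS : MeasurableSet S)
    {κ : Type*} {g : κ → E → ℂ} (hg : ∀ k, Differentiable ℝ (g k))
    (h0 : ∀ᵐ x ∂μ.restrict S, ∀ k, g k x = 0) :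
    ∀ᵐ x ∂μ.restrict S, ∀ k, fderiv ℝ (g k) x = 0 := by
  set Z : Set E := ⋂ k, {x | g k x = 0} with hZ
  have hZm : MeasurableSet Z :=
    (isClosed_iInter fun k => isClosed_eq (hg k).continuous continuous_const).measurableSet
  have hSZ := (ae_restrict_iff' (hS.inter hZm)).1 (ae_uniqueDiffWithinAt μ (hS.inter hZm))
  rw [ae_restrict_iff' hS] at h0 ⊢
  filter_upwards [h0, hSZ] with x hx hx' hxS k
  have hxZ : x ∈ S ∩ Z := ⟨hxS, mem_iInter.2 (hx hxS)⟩
  refine (hx' hxZ).eq (hg k x).hasFDerivAt.hasFDerivWithinAt ?_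
  exact (hasFDerivWithinAt_const (0 : ℂ) x _).congr (fun y hy => mem_iInter.1 hy.2 k) (hx hxS k)

theorem ae_evolve_eq_zero (μ : Measure E) [μ.IsAddHaarMeasure] {S : Set E} (hS : MeasurableSet S)
    {T : ℝ} {e : ι → E} {b : ι → E × ℝ → ℂ} (hb : ∀ i, ContDiff ℝ ∞ (b i))
    {u : E × ℝ → ℂ} (hu : ContDiff ℝ ∞ u)
    (ht : ∀ᵐ x ∂μ.restrict S, ∀ t ∈ Ioo 0 T, fderiv ℝ u (x, t) (0, 1) = 0)
    (h0 : ∀ᵐ x ∂μ.restrict S, ∀ i, ∀ t ∈ Ioo 0 T, b i (x, t) * u (x, t) = 0) :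
    ∀ᵐ x ∂μ.restrict S, ∀ t ∈ Ioo 0 T, evolve e b u (x, t) = 0 := by
  have hbu : ∀ i, Differentiable ℝ (fun q => b i q * u q) := fun i =>
    ((hb i).mul hu).differentiable (by simp)
  have hd : ∀ i t x, HasFDerivAt (fun y => b i (y, t) * u (y, t))
      (fderiv ℝ (fun q => b i q * u q) (x, t) ∘L ContinuousLinearMap.inl ℝ E ℝ) x :=
    fun i t x => HasFDerivAt.comp (g := fun q => b i q * u q) x (hbu i (x, t)).hasFDerivAt
      (hasFDerivAt_prodMk_left x t)
  have h1 := ae_fderiv_eq_zero μ hS (κ := ι × Ioo 0 T)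
    (g := fun k y => b k.1 (y, (k.2 : ℝ)) * u (y, (k.2 : ℝ)))
    (fun k x => (hd k.1 k.2 x).differentiableAt)
    (by filter_upwards [h0] with x hx k using hx k.1 k.2 k.2.2)
  filter_upwards [ht, h1] with x hx hx' t ht
  rw [evolve, hx t ht, zero_add]
  refine Finset.sum_eq_zero fun i _ => ?_
  have := hx' (i, ⟨t, ht⟩)
  simp only [(hd i t x).fderiv] at this
  simpa using congrArg (fun A : E →L[ℝ] ℂ => A (e i)) this

/-- If all the `bᵢ` vanish on `S × (0, T)`, then the positive powers of the evolution operator,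
applied to the constant `1`, vanish at almost every point of `S`. -/
theorem ae_iterate_evolve_one_eq_zero (μ : Measure E) [μ.IsAddHaarMeasure] {S : Set E}
    (hS : MeasurableSet S) {T : ℝ} {e : ι → E} {b : ι → E × ℝ → ℂ}
    (hb : ∀ i, ContDiff ℝ ∞ (b i)) (hbS : ∀ i, ∀ x ∈ S, ∀ t ∈ Ioo 0 T, b i (x, t) = 0) (j : ℕ) :
    ∀ᵐ x ∂μ.restrict S, ∀ t ∈ Ioo 0 T, (evolve e b)^[j + 1] (fun _ => 1) (x, t) = 0 := by
  have hbS' : ∀ u : E × ℝ → ℂ, ∀ᵐ x ∂μ.restrict S, ∀ i, ∀ t ∈ Ioo 0 T,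
      b i (x, t) * u (x, t) = 0 := fun u => by
    filter_upwards [ae_restrict_mem hS] with x hx i t ht
    rw [hbS i x hx t ht, zero_mul]
  induction j with
  | zero =>
    refine ae_evolve_eq_zero μ hS hb contDiff_const (Eventually.of_forall fun x t _ => ?_)
      (hbS' fun _ => 1)
    simp [fderiv_fun_const]
  | succ j ih =>
    rw [Function.iterate_succ_apply']
    have hu := contDiff_iterate_evolve (e := e) hb (contDiff_const (c := (1 : ℂ))) (j + 1)
    refine ae_evolve_eq_zero μ hS hb hu ?_ (hbS' _)
    filter_upwards [ih] with x hx t ht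
    have h1 := ((hu.differentiable (by simp) (x, t)).hasFDerivAt).comp_hasDerivAt t
        ((hasDerivAt_const t x).prodMk (hasDerivAt_id t))
    refine h1.unique ((hasDerivAt_const t (0 : ℂ)).congr_of_eventuallyEq ?_)
    filter_upwards [Ioo_mem_nhds ht.1 ht.2] with s hs using hx s hs

end AlmostEverywhere

/-! ### Functions of one variable with given weak derivatives -/

section OneVariable

theorem exists_Icc_of_isCompact_subset_Ioo {a b : ℝ} (hab : a < b) {K : Set ℝ} (hK : IsCompact K)
    (h : K ⊆ Ioo a b) : ∃ c d, a < c ∧ c < d ∧ d < b ∧ K ⊆ Ioo c d := by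
  rcases K.eq_empty_or_nonempty with rfl | hne
  · obtain ⟨c, hc⟩ := exists_between hab
    obtain ⟨d, hd⟩ := exists_between hc.2
    exact ⟨c, d, hc.1, hd.1, hd.2, empty_subset _⟩
  · obtain ⟨m, hm, hm'⟩ := hK.exists_isLeast hne
    obtain ⟨M, hM, hM'⟩ := hK.exists_isGreatest hne
    obtain ⟨c, hc⟩ := exists_between (h hm).1
    obtain ⟨d, hd⟩ := exists_between (h hM).2
    exact ⟨c, d, hc.1, hc.2.trans_le ((hm' hM).trans hd.1.le), hd.2,
      fun x hx => ⟨hc.2.trans_le (hm' hx), (hM' hx).trans_lt hd.1⟩⟩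

/-- A smooth function supported in `(c, d)` with zero integral has a smooth primitive supported in
`[c, d]`. -/
theorem exists_primitive_of_integral_eq_zero {c d : ℝ} {ζ : ℝ → ℝ}
    (hζ : ContDiff ℝ ∞ ζ) (hsupp : tsupport ζ ⊆ Ioo c d) (h0 : ∫ t, ζ t = 0) :
    ∃ η : ℝ → ℝ, ContDiff ℝ ∞ η ∧ tsupport η ⊆ Icc c d ∧ ∀ t, HasDerivAt η (ζ t) t := by
  have hz : ∀ t, t ∉ Ioo c d → ζ t = 0 := fun t ht =>
    image_eq_zero_of_notMem_tsupport fun h => ht (hsupp h)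
  have hder : ∀ t, HasDerivAt (fun t => ∫ s in c..t, ζ s) (ζ t) t := fun t =>
    intervalIntegral.integral_hasDerivAt_right (hζ.continuous.intervalIntegrable _ _)
      (hζ.continuous.stronglyMeasurableAtFilter _ _) hζ.continuous.continuousAt
  refine ⟨fun t => ∫ s in c..t, ζ s, ?_, ?_, hder⟩
  · rw [contDiff_infty_iff_deriv]
    exact ⟨fun t => (hder t).differentiableAt, by rwa [funext fun t => (hder t).deriv]⟩
  · refine closure_minimal (fun t ht => ?_) isClosed_Icc
    by_contra hcon
    refine ht ?_
    rcases le_or_gt c t with h | h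
    · have hdt : d ≤ t := by
        by_contra h'
        exact hcon ⟨h, (not_le.1 h').le⟩
      change ∫ s in c..t, ζ s = 0
      rw [intervalIntegral.integral_of_le h, setIntegral_eq_integral_of_forall_compl_eq_zero, h0]
      exact fun s hs => hz s fun h' => hs ⟨h'.1, h'.2.le.trans hdt⟩
    · change ∫ s in c..t, ζ s = 0
      rw [intervalIntegral.integral_symm, intervalIntegral.integral_of_le h.le,
        setIntegral_eq_zero_of_forall_eq_zero, neg_zero]
      exact fun s hs => hz s fun h' => (h'.1.trans_le hs.2).false

/-- The du Bois-Reymond lemma: a continuous function on an interval whose distributional derivative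
vanishes is constant. -/
theorem exists_const_of_forall_integral_deriv_eq_zero {a b : ℝ} (hab : a < b) {w : ℝ → ℂ}
    (hw : ContinuousOn w (Ioo a b))
    (H : ∀ η : ℝ → ℝ, ContDiff ℝ ∞ η → HasCompactSupport η → tsupport η ⊆ Ioo a b →
      ∫ t, deriv η t • w t = 0) :
    ∃ k, ∀ t ∈ Ioo a b, w t = k := by
  obtain ⟨c₀, hc₀⟩ := exists_between hab
  obtain ⟨r, hr, hr'⟩ := Metric.isOpen_iff.1 isOpen_Ioo c₀ hc₀
  let B : ContDiffBump c₀ := ⟨r / 4, r / 2, by positivity, by linarith⟩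
  set ρ₀ : ℝ → ℝ := B.normed volume with hρ₀
  have hρs : tsupport ρ₀ ⊆ Ioo a b := by
    rw [hρ₀, B.tsupport_normed_eq]
    exact (Metric.closedBall_subset_ball (by simp [B]; linarith)).trans hr'
  have hint : ∀ ρ : ℝ → ℝ, Continuous ρ → HasCompactSupport ρ → tsupport ρ ⊆ Ioo a b →
      Integrable fun t => ρ t • w t := by
    intro ρ hρ hρc hρs
    have hts : tsupport (fun t => ρ t • w t) ⊆ tsupport ρ := tsupport_smul_subset_left ρ w
    refine Continuous.integrable_of_hasCompactSupport ?_ hρc.smul_right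
    exact (hρ.continuousOn.smul hw).continuous_of_tsupport_subset isOpen_Ioo (hts.trans hρs)
  set k := ∫ t, ρ₀ t • w t with hk
  have hae : ∀ᵐ t, t ∈ Ioo a b → w t - k = 0 := by
    refine isOpen_Ioo.ae_eq_zero_of_integral_contDiff_smul_eq_zero
      ((hw.sub continuousOn_const).locallyIntegrableOn measurableSet_Ioo) ?_
    intro ρ hρ hρc hρsupp
    set m := ∫ t, ρ t with hm
    set ζ : ℝ → ℝ := fun t => ρ t - m * ρ₀ t with hζ
    have hζd : ContDiff ℝ ∞ ζ := hρ.sub (contDiff_const.mul B.contDiff_normed)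
    have hζs : tsupport ζ ⊆ tsupport ρ ∪ tsupport ρ₀ := by
      refine closure_minimal (fun t ht => ?_) ((isClosed_tsupport _).union (isClosed_tsupport _))
      by_contra hcon
      rw [mem_union, not_or] at hcon
      exact ht (by simp [hζ, image_eq_zero_of_notMem_tsupport hcon.1,
        image_eq_zero_of_notMem_tsupport hcon.2])
    have hρ₀c : HasCompactSupport ρ₀ := B.hasCompactSupport_normed
    obtain ⟨c, d, hac, hcd, hdb, hsub⟩ := exists_Icc_of_isCompact_subset_Ioo hab
      (hρc.isCompact.union hρ₀c.isCompact) (union_subset hρsupp hρs)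
    have hρi : Integrable ρ := hρ.continuous.integrable_of_hasCompactSupport hρc
    have hρ₀i : Integrable ρ₀ := B.continuous_normed.integrable_of_hasCompactSupport hρ₀c
    have hζ0 : ∫ t, ζ t = 0 := by
      rw [hζ, integral_sub hρi (hρ₀i.const_mul m), integral_const_mul, B.integral_normed, mul_one,
        sub_self]
    obtain ⟨η, hηd, hηs, hη⟩ := exists_primitive_of_integral_eq_zero hζd (hζs.trans hsub) hζ0
    have hηs' : tsupport η ⊆ Ioo a b := hηs.trans (Icc_subset_Ioo hac hdb)
    have h1 := H η hηd (HasCompactSupport.of_support_subset_isCompact isCompact_Icc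
      (subset_closure.trans hηs)) hηs'
    have h2 : ∀ t, deriv η t • w t = ρ t • w t - m • (ρ₀ t • w t) := fun t => by
      rw [(hη t).deriv, hζ, sub_smul, mul_smul]
    have i0 : Integrable fun t => m • (ρ₀ t • w t) :=
      (hint ρ₀ B.continuous_normed hρ₀c hρs).smul m
    rw [integral_congr_ae (Eventually.of_forall h2), integral_sub
      (hint ρ hρ.continuous hρc hρsupp) i0, integral_smul, ← hk] at h1
    have h3 : ∫ t, ρ t • k = m • k := integral_smul_const ρ k
    simp_rw [smul_sub]
    rw [integral_sub (hint ρ hρ.continuous hρc hρsupp) (hρi.smul_const k), h3, h1]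
  refine ⟨k, ?_⟩
  refine Measure.eqOn_open_of_ae_eq (μ := volume) ?_ isOpen_Ioo hw continuousOn_const
  rw [EventuallyEq, ae_restrict_iff' measurableSet_Ioo]
  filter_upwards [hae] with t ht h using sub_eq_zero.1 (ht h)

/-- A continuous function whose distributional derivative is a continuous function `h` is
differentiable with derivative `h`. -/
theorem hasDerivAt_of_forall_integral_eq_zero {a b : ℝ} {g h : ℝ → ℂ}
    (hg : ContinuousOn g (Ioo a b)) (hh : ContinuousOn h (Ioo a b))
    (H : ∀ η : ℝ → ℝ, ContDiff ℝ ∞ η → HasCompactSupport η → tsupport η ⊆ Ioo a b →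
      ∫ t, (deriv η t • g t + η t • h t) = 0) {t : ℝ} (ht : t ∈ Ioo a b) :
    HasDerivAt g (h t) t := by
  have hab : a < b := ht.1.trans ht.2
  set h₁ : ℝ → ℂ := fun s => ∫ r in t..s, h r with hh₁
  have hder : ∀ s ∈ Ioo a b, HasDerivAt h₁ (h s) s := by
    intro s hs
    have hsub : uIcc t s ⊆ Ioo a b := by
      rw [uIcc]
      exact Icc_subset_Ioo (lt_min ht.1 hs.1) (max_lt ht.2 hs.2)
    exact intervalIntegral.integral_hasDerivAt_right (hh.mono hsub).intervalIntegrable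
      (hh.stronglyMeasurableAtFilter isOpen_Ioo s hs) (hh.continuousAt (isOpen_Ioo.mem_nhds hs))
  have hh₁c : ContinuousOn h₁ (Ioo a b) := fun s hs => (hder s hs).continuousAt.continuousWithinAt
  have key : ∃ k, ∀ s ∈ Ioo a b, (g - h₁) s = k := by
    refine exists_const_of_forall_integral_deriv_eq_zero hab (hg.sub hh₁c) ?_
    intro η hη hηc hηs
    have hdη : Continuous (deriv η) := hη.continuous_deriv (by simp)
    have hdηs : tsupport (deriv η) ⊆ tsupport η := tsupport_deriv_subset
    have hcont : ∀ (σ : ℝ → ℝ) (w : ℝ → ℂ), Continuous σ → tsupport σ ⊆ tsupport η →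
        ContinuousOn w (Ioo a b) → Integrable (fun t => σ t • w t) := by
      intro σ w hσ hσs hw
      have hts : tsupport (fun t => σ t • w t) ⊆ tsupport σ := tsupport_smul_subset_left σ w
      refine Continuous.integrable_of_hasCompactSupport ?_
        (hηc.mono' (subset_closure.trans (hts.trans hσs)))
      exact (hσ.continuousOn.smul hw).continuous_of_tsupport_subset isOpen_Ioo
        (hts.trans (hσs.trans hηs))
    have i1 := hcont _ _ hdη hdηs hg
    have i2 := hcont _ _ hη.continuous le_rfl hh
    have i3 := hcont _ _ hdη hdηs hh₁c
    have i4 := hcont _ _ hη.continuous le_rfl hh₁c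
    have hprod : ∀ s, HasDerivAt (fun s => η s • h₁ s) (deriv η s • h₁ s + η s • h s) s := by
      intro s
      by_cases hs : s ∈ tsupport η
      · rw [add_comm]
        exact (hη.differentiable (by simp) s).hasDerivAt.smul (hder s (hηs hs))
      · have h0 : η =ᶠ[𝓝 s] 0 := notMem_tsupport_iff_eventuallyEq.1 hs
        have h1 : deriv η s = 0 := image_eq_zero_of_notMem_tsupport fun h => hs (hdηs h)
        rw [h1, h0.eq_of_nhds, Pi.zero_apply, zero_smul, zero_smul, add_zero]
        refine (hasDerivAt_const s (0 : ℂ)).congr_of_eventuallyEq ?_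
        filter_upwards [h0] with r hr
        simp [hr]
    have e1 := integral_eq_zero_of_hasDerivAt_of_integrable hprod (i3.add i2) i4
    have e2 := H η hη hηc hηs
    rw [integral_add i3 i2] at e1
    rw [integral_add i1 i2] at e2
    simp only [Pi.sub_apply, smul_sub]
    rw [integral_sub i1 i3]
    linear_combination e2 - e1
  obtain ⟨k, hk⟩ := key
  have heq : g =ᶠ[𝓝 t] fun s => k + h₁ s := by
    filter_upwards [isOpen_Ioo.mem_nhds ht] with s hs
    rw [← hk s hs, Pi.sub_apply, sub_add_cancel]
  exact ((hder t ht).const_add k).congr_of_eventuallyEq heq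

theorem hasDerivAt_taylor_sum {G : ℕ → ℝ → ℂ} {s : ℝ}
    (hG : ∀ j, HasDerivAt (G j) (G (j + 1) s) s) (t : ℝ) (N : ℕ) :
    HasDerivAt (fun s => ∑ j ∈ Finset.range (N + 1), ((t - s) ^ j / (j.factorial : ℝ)) • G j s)
      (((t - s) ^ N / (N.factorial : ℝ)) • G (N + 1) s) s := by
  induction N with
  | zero => simpa using hG 0
  | succ N ih =>
    simp_rw [Finset.sum_range_succ _ (N + 1)]
    have h1 : HasDerivAt (fun s : ℝ => (t - s) ^ (N + 1) / ((N + 1).factorial : ℝ))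
        (-((t - s) ^ N / (N.factorial : ℝ))) s := by
      refine ((((hasDerivAt_id' s).const_sub t).fun_pow (N + 1)).div_const
        ((N + 1).factorial : ℝ)).congr_deriv ?_
      rw [Nat.factorial_succ]
      push_cast
      have : (N.factorial : ℝ) ≠ 0 := by positivity
      have : (N + 1 : ℝ) ≠ 0 := by positivity
      field_simp
    refine (ih.fun_add (h1.fun_smul (hG (N + 1)))).congr_deriv ?_
    module

/-- If the derivative of order `N + 1` of a function on `(0, T)` is `O(t ^ (-N))`, then the function
has a limit at `0`, given by Taylor's formula centred at `τ`. -/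
theorem tendsto_zero_taylor {G : ℕ → ℝ → ℂ} {T τ C : ℝ} {N : ℕ} (hτ : τ ∈ Ioo 0 T)
    (hG : ∀ j, ∀ t ∈ Ioo 0 T, HasDerivAt (G j) (G (j + 1) t) t)
    (hC : ∀ t ∈ Ioc 0 τ, ‖G (N + 1) t‖ ≤ C / t ^ N) :
    Tendsto (G 0) (𝓝[>] 0) (𝓝 (∑ j ∈ Finset.range (N + 1), ((-τ) ^ j / (j.factorial : ℝ)) • G j τ
      - ∫ s in Ioc 0 τ, ((-s) ^ N / (N.factorial : ℝ)) • G (N + 1) s)) := by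
  have hcont : ContinuousOn (G (N + 1)) (Ioc 0 τ) := fun t ht =>
    (hG (N + 1) t ⟨ht.1, ht.2.trans_lt hτ.2⟩).continuousAt.continuousWithinAt
  have hker : ∀ t : ℝ, Continuous fun s : ℝ => (t - s) ^ N / (N.factorial : ℝ) := fun t => by
    fun_prop
  have formula : ∀ t ∈ Ioo 0 τ, G 0 t
      = ∑ j ∈ Finset.range (N + 1), ((t - τ) ^ j / (j.factorial : ℝ)) • G j τ
        - ∫ s in Ioc 0 τ, (Ioc t τ).indicator
          (fun s => ((t - s) ^ N / (N.factorial : ℝ)) • G (N + 1) s) s := by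
    intro t ht
    have hI : uIcc t τ ⊆ Ioc 0 τ := by
      rw [uIcc_of_le ht.2.le]
      exact fun s hs => ⟨ht.1.trans_le hs.1, hs.2⟩
    have h1 := intervalIntegral.integral_eq_sub_of_hasDerivAt
      (fun s hs => hasDerivAt_taylor_sum (G := G) (s := s)
        (fun j => hG j s ⟨(hI hs).1, (hI hs).2.trans_lt hτ.2⟩) t N)
      (ContinuousOn.intervalIntegrable ((hker t).continuousOn.smul (hcont.mono hI)))
    rw [setIntegral_indicator measurableSet_Ioc,
      inter_eq_self_of_subset_right (Ioc_subset_Ioc_left ht.1.le),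
      ← intervalIntegral.integral_of_le ht.2.le, h1]
    have h2 : ∑ j ∈ Finset.range (N + 1), ((t - t) ^ j / (j.factorial : ℝ)) • G j t = G 0 t := by
      rw [Finset.sum_eq_single 0]
      · simp
      · intro j _ hj
        simp [hj]
      · simp
    rw [h2]
    abel
  refine Tendsto.congr' (f₁ := fun t =>
    ∑ j ∈ Finset.range (N + 1), ((t - τ) ^ j / (j.factorial : ℝ)) • G j τ
        - ∫ s in Ioc 0 τ, (Ioc t τ).indicator
          (fun s => ((t - s) ^ N / (N.factorial : ℝ)) • G (N + 1) s) s) ?_ ?_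
  · filter_upwards [Ioo_mem_nhdsGT hτ.1] with t ht using (formula t ht).symm
  refine Tendsto.sub ?_ ?_
  · refine tendsto_nhdsWithin_of_tendsto_nhds ?_
    have : Continuous fun t : ℝ =>
        ∑ j ∈ Finset.range (N + 1), ((t - τ) ^ j / (j.factorial : ℝ)) • G j τ := by fun_prop
    simpa using this.tendsto 0
  · refine tendsto_integral_filter_of_dominated_convergence (fun _ => |C|) ?_ ?_ ?_ ?_
    · filter_upwards with t
      refine AEStronglyMeasurable.indicator ?_ measurableSet_Ioc
      exact (hker t).aestronglyMeasurable.smul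
        (hcont.aestronglyMeasurable measurableSet_Ioc)
    · filter_upwards [self_mem_nhdsWithin] with t ht
      filter_upwards [ae_restrict_mem measurableSet_Ioc] with s hs
      by_cases hst : s ∈ Ioc t τ
      · rw [indicator_of_mem hst, norm_smul, Real.norm_eq_abs, abs_div, abs_pow, Nat.abs_cast]
        have h1 : |t - s| ≤ s := by
          rw [abs_le]
          constructor <;> linarith [hst.1, mem_Ioi.1 ht]
        have h2 : |t - s| ^ N / (N.factorial : ℝ) ≤ s ^ N := by
          refine (div_le_self (by positivity) ?_).trans (pow_le_pow_left₀ (abs_nonneg _) h1 N)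
          exact_mod_cast Nat.one_le_iff_ne_zero.2 (Nat.factorial_ne_zero N)
        have h3 : 0 < s ^ N := pow_pos hs.1 N
        calc |t - s| ^ N / (N.factorial : ℝ) * ‖G (N + 1) s‖ ≤ s ^ N * (C / s ^ N) :=
              mul_le_mul h2 (hC s hs) (norm_nonneg _) h3.le
          _ = C := mul_div_cancel₀ _ h3.ne'
          _ ≤ |C| := le_abs_self C
      · rw [indicator_of_notMem hst, norm_zero]
        exact abs_nonneg C
    · exact integrable_const _
    · filter_upwards [ae_restrict_mem measurableSet_Ioc] with s hs
      have h1 : Continuous fun t : ℝ => ((t - s) ^ N / (N.factorial : ℝ)) • G (N + 1) s := by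
        fun_prop
      have h2 := tendsto_nhdsWithin_of_tendsto_nhds (s := Ioi 0) (h1.tendsto 0)
      rw [zero_sub] at h2
      refine h2.congr' ?_
      filter_upwards [Ioo_mem_nhdsGT hs.1] with t ht
      rw [indicator_of_mem (show s ∈ Ioc t τ from ⟨ht.2, hs.2⟩)]

end OneVariable

/-! ### Cutoff functions -/

section Cutoff

open scoped Convolution

variable {E : Type*} [NormedAddCommGroup E] [NormedSpace ℝ E] {ι : Type*}

theorem iteratedPartial_comp_smul (e : ι → E) {w : E → ℝ} (hw : ContDiff ℝ ∞ w) (r : ℝ)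
    (I : List ι) (x : E) :
    iteratedPartial e (fun y => w (r • y)) I x = r ^ I.length * iteratedPartial e w I (r • x) := by
  induction I generalizing x with
  | nil => simp [iteratedPartial]
  | cons i I ih =>
    change fderiv ℝ (iteratedPartial e (fun y => w (r • y)) I) x (e i)
      = _ * fderiv ℝ (iteratedPartial e w I) (r • x) (e i)
    rw [funext ih]
    have h1 : HasFDerivAt (fun y : E => r • y) (r • ContinuousLinearMap.id ℝ E) x :=
      (hasFDerivAt_id x).const_smul r
    have h2 := (((contDiff_iteratedPartial e hw I).differentiable (by simp)
      (r • x)).hasFDerivAt.comp x h1).const_mul (r ^ I.length)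
    have h3 := congrArg (fun A : E →L[ℝ] ℝ => A (e i)) h2.fderiv
    refine h3.trans ?_
    simp [pow_succ]
    ring

theorem hasCompactSupport_iteratedPartial (e : ι → E) {w : E → ℝ} (hw : HasCompactSupport w)
    (I : List ι) : HasCompactSupport (iteratedPartial e w I) := by
  induction I with
  | nil => exact hw
  | cons i I ih => exact ih.fderiv_apply (𝕜 := ℝ) (e i)

theorem iteratedPartial_convolution [MeasurableSpace E] [BorelSpace E] [FiniteDimensional ℝ E]
    (μ : Measure E) [μ.IsAddHaarMeasure] (e : ι → E) {g w : E → ℝ} (hg : LocallyIntegrable g μ)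
    (hw : ContDiff ℝ ∞ w) (hwc : HasCompactSupport w) (I : List ι) :
    iteratedPartial e (g ⋆[ContinuousLinearMap.lsmul ℝ ℝ, μ] w) I
      = g ⋆[ContinuousLinearMap.lsmul ℝ ℝ, μ] iteratedPartial e w I := by
  induction I with
  | nil => rfl
  | cons i I ih =>
    have hd := contDiff_iteratedPartial e hw I
    have hc := hasCompactSupport_iteratedPartial e hwc I
    ext x
    change fderiv ℝ (iteratedPartial e _ I) x (e i) = _
    rw [ih, (hc.hasFDerivAt_convolution_right (ContinuousLinearMap.lsmul ℝ ℝ) hg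
      (hd.of_le (by simp)) x).fderiv]
    exact convolution_precompR_apply (ContinuousLinearMap.lsmul ℝ ℝ) hg (hc.fderiv ℝ)
      (hd.continuous_fderiv (by simp)) x (e i)

/-- Smooth cutoff functions, equal to `1` near a compact set `S` and supported in its
`ε`-neighbourhood, whose partial derivatives of order `k` are `O(ε ^ (-k))` as `ε → 0`. -/
theorem exists_cutoff [FiniteDimensional ℝ E] {S : Set E} (hS : IsCompact S) (e : ι → E) :
    ∃ A : List ι → ℝ, ∀ ε : ℝ, 0 < ε → ∃ ψ : E → ℝ, ContDiff ℝ ∞ ψ ∧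
      (∀ x ∈ S, ∀ᶠ y in 𝓝 x, ψ y = 1) ∧ tsupport ψ ⊆ Metric.cthickening ε S ∧
      ∀ I x, |iteratedPartial e ψ I x| ≤ A I * (ε⁻¹) ^ I.length := by
  borelize E
  let μ : Measure E := Measure.addHaar
  let B : ContDiffBump (0 : E) := ⟨1 / 2, 1, by norm_num, by norm_num⟩
  set ρ : E → ℝ := B.normed μ with hρ
  have hρd : ContDiff ℝ ∞ ρ := B.contDiff_normed
  have hρc : HasCompactSupport ρ := B.hasCompactSupport_normed
  have hρ0 : ∀ x, ρ x ≠ 0 → ‖x‖ < 1 := fun x hx => by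
    have : x ∈ Function.support ρ := hx
    rw [hρ, B.support_normed_eq] at this
    simpa [B] using this
  refine ⟨fun I => (∫ x, |iteratedPartial e ρ I x| ∂μ) * 3 ^ I.length, fun ε hε => ?_⟩
  -- The cutoff is the indicator of the `2ε/3`-neighbourhood of `S`, smoothed at scale `ε/3`.
  set δ : ℝ := ε / 3 with hδ
  have hδ0 : 0 < δ := by positivity
  set A : Set E := (fun y : E => δ • y) ⁻¹' Metric.cthickening (2 * δ) S with hA
  have hAm : MeasurableSet A :=
    (Metric.isClosed_cthickening.preimage (continuous_const_smul δ)).measurableSet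
  set g : E → ℝ := A.indicator fun _ => 1 with hg
  have hgi : LocallyIntegrable g μ := (locallyIntegrable_const (1 : ℝ)).indicator hAm
  have hg1 : ∀ x, ‖g x‖ ≤ 1 := fun x => by
    rw [hg]
    by_cases h : x ∈ A <;> simp [h]
  set w : E → ℝ := g ⋆[ContinuousLinearMap.lsmul ℝ ℝ, μ] ρ with hw
  have hwd : ContDiff ℝ ∞ w := hρc.contDiff_convolution_right _ hgi hρd
  have hwx : ∀ x, w x = ∫ t, g t * ρ (x - t) ∂μ := fun x => rfl
  have hscale : ∀ x y : E, ρ (δ⁻¹ • x - y) ≠ 0 → ‖x - δ • y‖ < δ := by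
    intro x y h
    have h1 := hρ0 _ h
    have h2 : x - δ • y = δ • (δ⁻¹ • x - y) := by
      rw [smul_sub, smul_smul, mul_inv_cancel₀ hδ0.ne', one_smul]
    rw [h2, norm_smul, Real.norm_of_nonneg hδ0.le]
    nlinarith
  refine ⟨fun x => w (δ⁻¹ • x), hwd.comp (contDiff_const_smul _), ?_, ?_, ?_⟩
  · intro x₀ hx₀
    filter_upwards [Metric.ball_mem_nhds x₀ hδ0] with x hx
    have h1 : ∀ t, g t * ρ (δ⁻¹ • x - t) = ρ (δ⁻¹ • x - t) := by
      intro t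
      by_cases ht : ρ (δ⁻¹ • x - t) = 0
      · rw [ht, mul_zero]
      · have h2 := hscale x t ht
        have h3 : t ∈ A := by
          refine Metric.mem_cthickening_of_dist_le _ x₀ _ _ hx₀ ?_
          have := dist_triangle (δ • t) x x₀
          rw [Metric.mem_ball] at hx
          rw [norm_sub_rev, ← dist_eq_norm] at h2
          change dist (δ • t) x₀ ≤ _
          linarith
        rw [hg, indicator_of_mem h3, one_mul]
    rw [hwx, integral_congr_ae (Eventually.of_forall h1), integral_sub_left_eq_self ρ μ]
    exact B.integral_normed
  · refine closure_minimal (fun x hx => ?_) Metric.isClosed_cthickening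
    simp only [Function.mem_support, hwx] at hx
    obtain ⟨t, ht⟩ : ∃ t, g t * ρ (δ⁻¹ • x - t) ≠ 0 := by
      by_contra! hcon
      exact hx (by simp [hcon])
    have htA : t ∈ A := by
      by_contra h
      exact ht (by rw [hg, indicator_of_notMem h, zero_mul])
    have h1 := hscale x t (right_ne_zero_of_mul ht)
    rw [hA, mem_preimage, hS.cthickening_eq_biUnion_closedBall (by positivity)] at htA
    simp only [mem_iUnion] at htA
    obtain ⟨y, hy, hyt⟩ := htA
    refine Metric.mem_cthickening_of_dist_le x y _ _ hy ?_
    rw [Metric.mem_closedBall, dist_eq_norm] at hyt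
    rw [dist_eq_norm]
    calc ‖x - y‖ = ‖(x - δ • t) + (δ • t - y)‖ := by rw [sub_add_sub_cancel]
      _ ≤ ‖x - δ • t‖ + ‖δ • t - y‖ := norm_add_le _ _
      _ ≤ ε := by linarith
  · intro I x
    have hc := hasCompactSupport_iteratedPartial e hρc I
    have hi : Integrable (iteratedPartial e ρ I) μ :=
      (contDiff_iteratedPartial e hρd I).continuous.integrable_of_hasCompactSupport hc
    have hbound : ∀ z, |iteratedPartial e w I z| ≤ ∫ x, |iteratedPartial e ρ I x| ∂μ := by
      intro z
      rw [hw, iteratedPartial_convolution μ e hgi hρd hρc, ← Real.norm_eq_abs,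
        ← integral_sub_left_eq_self (fun x => |iteratedPartial e ρ I x|) μ z]
      refine norm_integral_le_of_norm_le (hi.abs.comp_sub_left z) (Eventually.of_forall fun t => ?_)
      rw [ContinuousLinearMap.lsmul_apply, norm_smul, Real.norm_eq_abs (iteratedPartial e ρ I _)]
      exact mul_le_of_le_one_left (abs_nonneg _) (hg1 t)
    rw [iteratedPartial_comp_smul e hwd, abs_mul, abs_of_nonneg (by positivity)]
    have h3 : δ⁻¹ = 3 * ε⁻¹ := by rw [hδ, inv_div]; ring
    calc δ⁻¹ ^ I.length * |iteratedPartial e w I (δ⁻¹ • x)|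
        ≤ δ⁻¹ ^ I.length * ∫ x, |iteratedPartial e ρ I x| ∂μ := by gcongr; exact hbound _
      _ = _ := by rw [h3, mul_pow]; ring

end Cutoff

/-! ### Pairings of a weak solution with smooth functions -/

section Pairing

set_option linter.unusedSectionVars false

variable {E : Type*} [NormedAddCommGroup E] [NormedSpace ℝ E] [FiniteDimensional ℝ E]
  [MeasurableSpace E] [BorelSpace E] {ι : Type*} [Fintype ι]
  {μ : Measure E} [μ.IsAddHaarMeasure]

/-- The pairing `∫_K u(x, t) f(x, t) dx` at time `t`. -/
noncomputable def pairing (μ : Measure E) (K : Set E) (f u : E × ℝ → ℂ) (t : ℝ) : ℂ :=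
  ∫ x in K, u (x, t) * f (x, t) ∂μ

variable {U K : Set E} {T : ℝ} {f : E × ℝ → ℂ}

theorem continuousOn_slice (hf : ContinuousOn f (U ×ˢ Ioo 0 T)) (hKU : K ⊆ U) {t : ℝ}
    (ht : t ∈ Ioo 0 T) : ContinuousOn (fun x => f (x, t)) K :=
  hf.comp (by fun_prop) fun _ hx => ⟨hKU hx, ht⟩

theorem integrableOn_slice (hf : ContinuousOn f (U ×ˢ Ioo 0 T)) (hK : IsCompact K) (hKU : K ⊆ U)
    {t : ℝ} (ht : t ∈ Ioo 0 T) : IntegrableOn (fun x => f (x, t)) K μ :=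
  (continuousOn_slice hf hKU ht).integrableOn_compact hK

theorem integrableOn_mul_slice (hf : ContinuousOn f (U ×ˢ Ioo 0 T)) (hK : IsCompact K)
    (hKU : K ⊆ U) {u : E × ℝ → ℂ} (hu : Continuous u) {t : ℝ} (ht : t ∈ Ioo 0 T) :
    IntegrableOn (fun x => u (x, t) * f (x, t)) K μ :=
  ((hu.comp (by fun_prop : Continuous fun x : E => (x, t))).continuousOn.mul
    (continuousOn_slice hf hKU ht)).integrableOn_compact hK

theorem norm_pairing_le (hf : ContinuousOn f (U ×ˢ Ioo 0 T)) (hK : IsCompact K)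
    (hKU : K ⊆ U) {u : E × ℝ → ℂ} {t M : ℝ} (ht : t ∈ Ioo 0 T)
    (hM : ∀ x ∈ K, ‖u (x, t)‖ ≤ M) :
    ‖pairing μ K f u t‖ ≤ M * ∫ x in K, ‖f (x, t)‖ ∂μ := by
  rw [← integral_const_mul]
  refine norm_integral_le_of_norm_le ((integrableOn_slice hf hK hKU ht).norm.const_mul M) ?_
  filter_upwards [ae_restrict_mem hK.measurableSet] with x hx
  rw [norm_mul]
  exact mul_le_mul_of_nonneg_right (hM x hx) (norm_nonneg _)

theorem continuousOn_pairing (hf : ContinuousOn f (U ×ˢ Ioo 0 T)) (hU : IsOpen U)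
    (hK : IsCompact K) (hKU : K ⊆ U) {u : E × ℝ → ℂ} (hu : Continuous u)
    (hu0 : ∀ p : E × ℝ, p.1 ∉ K → u p = 0) : ContinuousOn (pairing μ K f u) (Ioo 0 T) := by
  have h1 : pairing μ K f u = fun t => ∫ x, u (x, t) * f (x, t) ∂μ := by
    ext t
    exact setIntegral_eq_integral_of_forall_compl_eq_zero fun x hx => by
      rw [hu0 (x, t) hx, zero_mul]
  rw [h1]
  refine continuousOn_integral_of_compact_support hK ?_ fun t x _ hx => by
    rw [hu0 (x, t) hx, zero_mul]
  rintro ⟨t, x⟩ ⟨ht, -⟩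
  refine ContinuousAt.continuousWithinAt ?_
  by_cases hx : x ∈ K
  · refine ContinuousAt.mul (f := fun q : ℝ × E => u (q.2, q.1)) (g := fun q => f (q.2, q.1))
      (by fun_prop) ?_
    have h2 : ContinuousAt f (x, t) :=
      hf.continuousAt ((hU.prod isOpen_Ioo).mem_nhds ⟨hKU hx, ht⟩)
    exact ContinuousAt.comp (f := fun q : ℝ × E => (q.2, q.1)) (x := (t, x)) h2 (by fun_prop)
  · have h2 : (fun q : ℝ × E => u (q.2, q.1) * f (q.2, q.1)) =ᶠ[𝓝 (t, x)] fun _ => 0 := by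
      filter_upwards [(hK.isClosed.isOpen_compl.preimage continuous_snd).mem_nhds hx] with q hq
      rw [hu0 (q.2, q.1) hq, zero_mul]
    exact continuousAt_const.congr h2.symm

/-- Fubini's theorem for the pairing of `f` with `∂ₜ(η u) + ∑ᵢ ∂ᵢ(bᵢ η u)`. -/
theorem integral_evolve_eq (hf : ContinuousOn f (U ×ˢ Ioo 0 T))
    (hK : IsCompact K) (hKU : K ⊆ U) {e : ι → E} {b : ι → E × ℝ → ℂ}
    (hb : ∀ i, ContDiff ℝ ∞ (b i)) {u : E × ℝ → ℂ} (hu : ContDiff ℝ ∞ u)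
    (hu0 : ∀ p : E × ℝ, p.1 ∉ K → u p = 0) {η : ℝ → ℝ} (hη : ContDiff ℝ ∞ η)
    (hηc : HasCompactSupport η) (hηs : tsupport η ⊆ Ioo 0 T) :
    ∫ p in U ×ˢ Ioo 0 T, f p * evolve e b (fun q => (η q.2 : ℂ) * u q) p ∂(μ.prod volume)
      = ∫ t, (deriv η t • pairing μ K f u t + η t • pairing μ K f (evolve e b u) t) := by
  have hDu0 : ∀ p : E × ℝ, p.1 ∉ K → evolve e b u p = 0 := fun p hp =>
    iterate_evolve_eq_zero hK.isClosed hu0 1 hp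
  have hDu := contDiff_evolve (e := e) hb hu
  have hdη : Continuous (deriv η) := hη.continuous_deriv (by simp)
  set F : E × ℝ → ℂ := fun p =>
    f p * (((deriv η p.2 : ℝ) : ℂ) * u p + (η p.2 : ℂ) * evolve e b u p) with hF
  have hF1 : ∀ p, f p * evolve e b (fun q => (η q.2 : ℂ) * u q) p = F p := fun p => by
    rw [evolve_mul_time (fun i => (hb i).differentiable (by simp)) (hu.differentiable (by simp))
      (hη.differentiable (by simp))]
  have hηz : ∀ t, t ∉ tsupport η → η t = 0 ∧ deriv η t = 0 := fun t ht =>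
    ⟨image_eq_zero_of_notMem_tsupport ht,
      image_eq_zero_of_notMem_tsupport fun h => ht (tsupport_deriv_subset h)⟩
  have hF0 : ∀ p, p ∉ K ×ˢ tsupport η → F p = 0 := by
    intro p hp
    rw [mem_prod, not_and_or] at hp
    rcases hp with h | h
    · simp [hF, hu0 p h, hDu0 p h]
    · simp [hF, (hηz p.2 h).1, (hηz p.2 h).2]
  have hsub : K ×ˢ tsupport η ⊆ U ×ˢ Ioo 0 T := prod_mono hKU hηs
  have hFi : IntegrableOn F (K ×ˢ tsupport η) (μ.prod volume) := by
    refine ContinuousOn.integrableOn_compact (hK.prod hηc.isCompact) ((hf.mono hsub).mul ?_)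
    refine Continuous.continuousOn ?_
    exact ((Complex.continuous_ofReal.comp (hdη.comp continuous_snd)).mul hu.continuous).add
      ((Complex.continuous_ofReal.comp (hη.continuous.comp continuous_snd)).mul hDu.continuous)
  rw [integral_congr_ae (Eventually.of_forall hF1),
    setIntegral_eq_integral_of_forall_compl_eq_zero fun p hp => hF0 p fun h => hp (hsub h),
    ← setIntegral_eq_integral_of_forall_compl_eq_zero hF0]
  rw [IntegrableOn, ← Measure.prod_restrict] at hFi
  rw [← Measure.prod_restrict, integral_prod_symm F hFi,
    ← setIntegral_eq_integral_of_forall_compl_eq_zero (s := tsupport η)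
      (f := fun t => deriv η t • pairing μ K f u t + η t • pairing μ K f (evolve e b u) t)
      fun t ht => by rw [(hηz t ht).1, (hηz t ht).2, zero_smul, zero_smul, add_zero]]
  refine setIntegral_congr_fun (isClosed_tsupport η).measurableSet fun t ht => ?_
  have i1 := integrableOn_mul_slice (μ := μ) hf hK hKU hu.continuous (hηs ht)
  have i2 := integrableOn_mul_slice (μ := μ) hf hK hKU hDu.continuous (hηs ht)
  have j1 : IntegrableOn (fun x => deriv η t • (u (x, t) * f (x, t))) K μ := i1.smul (deriv η t)
  have j2 : IntegrableOn (fun x => η t • (evolve e b u (x, t) * f (x, t))) K μ := i2.smul (η t)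
  simp only [pairing]
  rw [← integral_smul, ← integral_smul, ← integral_add j1 j2]
  refine integral_congr_ae (Eventually.of_forall fun x => ?_)
  simp only [hF, Complex.real_smul]
  ring

/-- The weak form of `L f = 0` on `U × (0, T)`, tested only against products `η(t) u(x, t)` with
`η` supported in `(0, T')` and `u` supported in `K × ℝ`. -/
def SolvesOn (μ : Measure E) (e : ι → E) (b : ι → E × ℝ → ℂ) (U K : Set E) (T T' : ℝ)
    (f : E × ℝ → ℂ) : Prop :=
  ∀ u : E × ℝ → ℂ, ContDiff ℝ ∞ u → (∀ p : E × ℝ, p.1 ∉ K → u p = 0) →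
    ∀ η : ℝ → ℝ, ContDiff ℝ ∞ η → HasCompactSupport η → tsupport η ⊆ Ioo 0 T' →
      ∫ p in U ×ˢ Ioo 0 T, f p * evolve e b (fun q => (η q.2 : ℂ) * u q) p ∂(μ.prod volume) = 0

variable {T' : ℝ} {e : ι → E} {b : ι → E × ℝ → ℂ}

/-- The weak equation in classical form: differentiating the pairing with `u` amounts to applying the
evolution operator to `u`. -/
theorem SolvesOn.hasDerivAt_pairing (hsol : SolvesOn μ e b U K T T' f) (hT : T' ≤ T)
    (hf : ContinuousOn f (U ×ˢ Ioo 0 T)) (hU : IsOpen U)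
    (hK : IsCompact K) (hKU : K ⊆ U)
    (hb : ∀ i, ContDiff ℝ ∞ (b i)) {u : E × ℝ → ℂ} (hu : ContDiff ℝ ∞ u)
    (hu0 : ∀ p : E × ℝ, p.1 ∉ K → u p = 0) {t : ℝ} (ht : t ∈ Ioo 0 T') :
    HasDerivAt (pairing μ K f u) (pairing μ K f (evolve e b u) t) t := by
  have hsub : Ioo 0 T' ⊆ Ioo 0 T := Ioo_subset_Ioo_right hT
  refine hasDerivAt_of_forall_integral_eq_zero
    ((continuousOn_pairing hf hU hK hKU hu.continuous hu0).mono hsub)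
    ((continuousOn_pairing hf hU hK hKU (contDiff_evolve hb hu).continuous
      fun p hp => iterate_evolve_eq_zero hK.isClosed hu0 1 hp).mono hsub)
    (fun η hη hηc hηs => ?_) ht
  rw [← integral_evolve_eq hf hK hKU hb hu hu0 hη hηc (hηs.trans hsub)]
  exact hsol u hu hu0 η hη hηc hηs

/-- Growth `O(t ^ (-N))` of the `L¹` norms as `t → 0` is a uniform bound on `(0, τ]`. -/
theorem exists_growth_bound (hf : ContinuousOn f (U ×ˢ Ioo 0 T)) (hK : IsCompact K) (hKU : K ⊆ U)
    {N : ℕ} {C : ℝ} (hC : ∀ᶠ t in 𝓝[>] (0 : ℝ), ∫ x in K, ‖f (x, t)‖ ∂μ ≤ C / t ^ N)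
    {τ : ℝ} (hτ : τ ∈ Ioo 0 T) :
    ∃ C', 0 ≤ C' ∧ ∀ t ∈ Ioc 0 τ, ∫ x in K, ‖f (x, t)‖ ∂μ ≤ C' / t ^ N := by
  obtain ⟨t₀, ht₀, h₀⟩ := mem_nhdsGT_iff_exists_Ioo_subset.1 hC
  obtain ⟨s, hs0, hs⟩ := exists_between (lt_min (mem_Ioi.1 ht₀) hτ.1)
  have hsub : K ×ˢ Icc s τ ⊆ U ×ˢ Ioo 0 T :=
    prod_mono hKU fun t ht => ⟨hs0.trans_le ht.1, ht.2.trans_lt hτ.2⟩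
  obtain ⟨M, hM⟩ := (hK.prod isCompact_Icc).exists_bound_of_continuousOn (hf.mono hsub)
  have hM' : ∀ t ∈ Icc s τ, ∫ x in K, ‖f (x, t)‖ ∂μ ≤ |M| * μ.real K := by
    intro t ht
    have h := norm_setIntegral_le_of_norm_le_const (μ := μ) (f := fun x => ‖f (x, t)‖)
      hK.measure_lt_top (C := |M|)
      (fun x hx => by simpa using (hM (x, t) ⟨hx, ht⟩).trans (le_abs_self M))
    exact (le_abs_self _).trans h
  refine ⟨|C| + |M| * μ.real K * τ ^ N, by have := hτ.1.le; positivity, fun t ht => ?_⟩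
  have htN : 0 < t ^ N := pow_pos ht.1 N
  rcases lt_or_ge t s with h | h
  · refine (h₀ ⟨ht.1, h.trans (hs.trans_le (min_le_left _ _))⟩ : _ ≤ C / t ^ N).trans ?_
    gcongr
    have h1 : 0 ≤ |M| * μ.real K * τ ^ N := by have := hτ.1.le; positivity
    linarith [le_abs_self C]
  · rw [le_div_iff₀ htN]
    have h1 : t ^ N ≤ τ ^ N := pow_le_pow_left₀ ht.1.le ht.2 N
    have h2 : 0 ≤ |M| * μ.real K := by positivity
    nlinarith [hM' t ⟨h, ht.2⟩, abs_nonneg C, mul_le_mul_of_nonneg_right (hM' t ⟨h, ht.2⟩) htN.le,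
      mul_le_mul_of_nonneg_left h1 h2]

/-- Taylor's formula at time `0`, centred at `τ` and with integral remainder, for the pairing of `f`
with `u 0`, where `u (j + 1)` is the function whose pairing with `f` is the derivative of the pairing
of `f` with `u j`. -/
noncomputable def taylorTrace (μ : Measure E) (K : Set E) (f : E × ℝ → ℂ) (τ : ℝ) (N : ℕ)
    (u : ℕ → E × ℝ → ℂ) : ℂ :=
  ∑ j ∈ Finset.range (N + 1), ((-τ) ^ j / (j.factorial : ℝ)) • pairing μ K f (u j) τ
    - ∫ s in Ioc 0 τ, ((-s) ^ N / (N.factorial : ℝ)) • pairing μ K f (u (N + 1)) s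

theorem SolvesOn.tendsto_pairing (hsol : SolvesOn μ e b U K T T' f) (hT : T' ≤ T)
    (hf : ContinuousOn f (U ×ˢ Ioo 0 T)) (hU : IsOpen U)
    (hK : IsCompact K) (hKU : K ⊆ U) (hb : ∀ i, ContDiff ℝ ∞ (b i))
    {τ C : ℝ} {N : ℕ} (hτ : τ ∈ Ioo 0 T')
    (hC : ∀ t ∈ Ioc 0 τ, ∫ x in K, ‖f (x, t)‖ ∂μ ≤ C / t ^ N)
    {u : E × ℝ → ℂ} (hu : ContDiff ℝ ∞ u) (hu0 : ∀ p : E × ℝ, p.1 ∉ K → u p = 0) :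
    Tendsto (pairing μ K f u) (𝓝[>] 0)
      (𝓝 (taylorTrace μ K f τ N fun j => (evolve e b)^[j] u)) := by
  obtain ⟨M, hM⟩ := (hK.prod (isCompact_Icc (a := 0) (b := τ))).exists_bound_of_continuousOn
    (contDiff_iterate_evolve (e := e) hb hu (N + 1)).continuous.continuousOn
  refine tendsto_zero_taylor (G := fun j => pairing μ K f ((evolve e b)^[j] u)) (C := |M| * C) hτ
    (fun j t ht => ?_) (fun t ht => ?_)
  · rw [Function.iterate_succ_apply']
    exact hsol.hasDerivAt_pairing hT hf hU hK hKU hb (contDiff_iterate_evolve hb hu j)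
      (fun p hp => iterate_evolve_eq_zero hK.isClosed hu0 j hp) ht
  · refine (norm_pairing_le hf hK hKU (M := |M|) ⟨ht.1, ht.2.trans_lt (hτ.2.trans_le hT)⟩
      fun x hx => (hM (x, t) ⟨hx, ht.1.le, ht.2⟩).trans (le_abs_self M)).trans ?_
    rw [mul_div_assoc]
    exact mul_le_mul_of_nonneg_left (hC t ht) (abs_nonneg M)

theorem norm_remainder_le (hf : ContinuousOn f (U ×ˢ Ioo 0 T)) (hK : IsCompact K) (hKU : K ⊆ U)
    {τ C M : ℝ} {N : ℕ} (hτ : τ ∈ Ioo 0 T) (hM0 : 0 ≤ M)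
    (hC : ∀ t ∈ Ioc 0 τ, ∫ x in K, ‖f (x, t)‖ ∂μ ≤ C / t ^ N) {u : E × ℝ → ℂ}
    (hM : ∀ x ∈ K, ∀ t ∈ Ioc 0 τ, ‖u (x, t)‖ ≤ M) {s : ℝ} (hs : s ∈ Ioc 0 τ) :
    ‖((-s) ^ N / (N.factorial : ℝ)) • pairing μ K f u s‖ ≤ M * C := by
  have h3 : 0 < s ^ N := pow_pos hs.1 N
  rw [norm_smul, Real.norm_eq_abs, abs_div, abs_pow, Nat.abs_cast, abs_neg, abs_of_pos hs.1]
  have h1 : s ^ N / (N.factorial : ℝ) ≤ s ^ N :=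
    div_le_self h3.le (by exact_mod_cast Nat.one_le_iff_ne_zero.2 (Nat.factorial_ne_zero N))
  have h2 := (norm_pairing_le (μ := μ) hf hK hKU (M := M) ⟨hs.1, hs.2.trans_lt hτ.2⟩
    fun x hx => hM x hx s hs).trans (mul_le_mul_of_nonneg_left (hC s hs) hM0)
  calc s ^ N / (N.factorial : ℝ) * ‖pairing μ K f u s‖ ≤ s ^ N * (M * (C / s ^ N)) :=
        mul_le_mul h1 h2 (norm_nonneg _) h3.le
    _ = M * C := by field_simp

theorem exists_norm_taylorTrace_le (hf : ContinuousOn f (U ×ˢ Ioo 0 T)) (hK : IsCompact K)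
    (hKU : K ⊆ U) {τ C : ℝ} {N : ℕ} (hτ : τ ∈ Ioo 0 T)
    (hC : ∀ t ∈ Ioc 0 τ, ∫ x in K, ‖f (x, t)‖ ∂μ ≤ C / t ^ N) :
    ∃ A, 0 ≤ A ∧ ∀ (u : ℕ → E × ℝ → ℂ) (M : ℝ), 0 ≤ M →
      (∀ j ≤ N + 1, ∀ x ∈ K, ∀ t ∈ Ioc 0 τ, ‖u j (x, t)‖ ≤ M) →
        ‖taylorTrace μ K f τ N u‖ ≤ A * M := by
  set I := ∫ x in K, ‖f (x, τ)‖ ∂μ with hI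
  have hI0 : 0 ≤ I := integral_nonneg fun x => norm_nonneg _
  have hτ' : τ ∈ Ioc 0 τ := ⟨hτ.1, le_rfl⟩
  refine ⟨∑ j ∈ Finset.range (N + 1), |(-τ) ^ j / (j.factorial : ℝ)| * I + |C| * τ,
    by have := hτ.1.le; positivity, fun u M hM0 hM => ?_⟩
  rw [add_mul]
  refine (norm_sub_le _ _).trans (add_le_add ?_ ?_)
  · rw [Finset.sum_mul]
    refine (norm_sum_le _ _).trans (Finset.sum_le_sum fun j hj => ?_)
    rw [norm_smul, Real.norm_eq_abs, mul_assoc, mul_comm I]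
    refine mul_le_mul_of_nonneg_left ?_ (abs_nonneg _)
    exact norm_pairing_le hf hK hKU hτ fun x hx =>
      hM j (by have := Finset.mem_range.1 hj; omega) x hx τ hτ'
  · refine (norm_setIntegral_le_of_norm_le_const (C := M * |C|) (by simp) fun s hs =>
      (norm_remainder_le hf hK hKU hτ hM0 hC (hM (N + 1) le_rfl) hs).trans ?_).trans_eq ?_
    · exact mul_le_mul_of_nonneg_left (le_abs_self C) hM0
    · rw [Real.volume_real_Ioc_of_le hτ.1.le]
      ring

/-- Dominated convergence for the Taylor formula: if `u m 0 → v` and `u m j → 0` for `j ≥ 1`,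
boundedly and almost everywhere in `x`, then only the term of order `0` survives. -/
theorem tendsto_taylorTrace (hf : ContinuousOn f (U ×ˢ Ioo 0 T)) (hK : IsCompact K)
    (hU : IsOpen U) (hKU : K ⊆ U) {τ C : ℝ} {N : ℕ} (hτ : τ ∈ Ioo 0 T)
    (hC : ∀ t ∈ Ioc 0 τ, ∫ x in K, ‖f (x, t)‖ ∂μ ≤ C / t ^ N)
    {u : ℕ → ℕ → E × ℝ → ℂ} {M : ℝ} (hM0 : 0 ≤ M) (hu : ∀ m j, Continuous (u m j))
    (hu0 : ∀ m j, ∀ p : E × ℝ, p.1 ∉ K → u m j p = 0)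
    (hM : ∀ m, ∀ j ≤ N + 1, ∀ x ∈ K, ∀ t ∈ Ioc 0 τ, ‖u m j (x, t)‖ ≤ M)
    {v : E → ℂ} (hv : ∀ᵐ x ∂μ.restrict K, Tendsto (fun m => u m 0 (x, τ)) atTop (𝓝 (v x)))
    (hlim : ∀ j, ∀ᵐ x ∂μ.restrict K, ∀ t ∈ Ioc 0 τ,
      Tendsto (fun m => u m (j + 1) (x, t)) atTop (𝓝 0)) :
    Tendsto (fun m => taylorTrace μ K f τ N (u m)) atTop
      (𝓝 (∫ x in K, v x * f (x, τ) ∂μ)) := by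
  have hτ' : τ ∈ Ioc 0 τ := ⟨hτ.1, le_rfl⟩
  have hpair : ∀ j ≤ N + 1, ∀ t ∈ Ioc 0 τ, ∀ w : E → ℂ,
      (∀ᵐ x ∂μ.restrict K, Tendsto (fun m => u m j (x, t)) atTop (𝓝 (w x))) →
      Tendsto (fun m => pairing μ K f (u m j) t) atTop (𝓝 (∫ x in K, w x * f (x, t) ∂μ)) := by
    intro j hj t ht w hw
    have htT : t ∈ Ioo 0 T := ⟨ht.1, ht.2.trans_lt hτ.2⟩
    refine tendsto_integral_of_dominated_convergence (fun x => M * ‖f (x, t)‖) (fun m => ?_) ?_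
      (fun m => ?_) ?_
    · exact (integrableOn_mul_slice hf hK hKU (hu m j) htT).aestronglyMeasurable
    · exact (integrableOn_slice hf hK hKU htT).norm.const_mul M
    · filter_upwards [ae_restrict_mem hK.measurableSet] with x hx
      rw [norm_mul]
      exact mul_le_mul_of_nonneg_right (hM m j hj x hx t ht) (norm_nonneg _)
    · filter_upwards [hw] with x hx using hx.mul_const _
  have hpair0 : ∀ j ≤ N, ∀ t ∈ Ioc 0 τ,
      Tendsto (fun m => pairing μ K f (u m (j + 1)) t) atTop (𝓝 0) := by
    intro j hj t ht
    have := hpair (j + 1) (by omega) t ht (fun _ => 0)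
      (by filter_upwards [hlim j] with x hx using hx t ht)
    simpa using this
  have h1 : Tendsto (fun m => ∑ j ∈ Finset.range (N + 1),
      ((-τ) ^ j / (j.factorial : ℝ)) • pairing μ K f (u m j) τ) atTop
      (𝓝 (∫ x in K, v x * f (x, τ) ∂μ)) := by
    simp_rw [Finset.sum_range_succ']
    have h2 := tendsto_finsetSum (Finset.range N) (fun j hj =>
      (hpair0 j (Finset.mem_range.1 hj).le τ hτ').const_smul
        ((-τ) ^ (j + 1) / ((j + 1).factorial : ℝ)))
    have h3 := (hpair 0 (Nat.zero_le _) τ hτ' v hv).const_smul ((-τ) ^ 0 / (Nat.factorial 0 : ℝ))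
    simpa using h2.add h3
  have h2 : Tendsto (fun m => ∫ s in Ioc 0 τ,
      ((-s) ^ N / (N.factorial : ℝ)) • pairing μ K f (u m (N + 1)) s) atTop (𝓝 0) := by
    have h3 := tendsto_integral_of_dominated_convergence (μ := volume.restrict (Ioc 0 τ))
      (F := fun m s => ((-s) ^ N / (N.factorial : ℝ)) • pairing μ K f (u m (N + 1)) s)
      (f := fun _ => (0 : ℂ)) (fun _ => M * C) (fun m => ?_) (integrable_const _) (fun m => ?_) ?_
    · simpa using h3
    · have hker : Continuous fun s : ℝ => (-s) ^ N / (N.factorial : ℝ) := by fun_prop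
      refine ContinuousOn.aestronglyMeasurable (hker.continuousOn.smul ?_) measurableSet_Ioc
      exact (continuousOn_pairing hf hU hK hKU (hu m _) (hu0 m _)).mono
        fun t ht => ⟨ht.1, ht.2.trans_lt hτ.2⟩
    · filter_upwards [ae_restrict_mem measurableSet_Ioc] with s hs
      exact norm_remainder_le hf hK hKU hτ hM0 hC (hM m (N + 1) le_rfl) hs
    · filter_upwards [ae_restrict_mem measurableSet_Ioc] with s hs
      simpa using (hpair0 N le_rfl s hs).const_smul ((-s) ^ N / (N.factorial : ℝ))
  simpa [taylorTrace] using h1.sub h2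

/-- Taylor's formula for the trace has finite order as a functional of `φ`. -/
theorem exists_norm_taylorTrace_iterate_le (hf : ContinuousOn f (U ×ˢ Ioo 0 T)) (hK : IsCompact K)
    (hKU : K ⊆ U) (hb : ∀ i, ContDiff ℝ ∞ (b i)) {τ C : ℝ} {N : ℕ} (hτ : τ ∈ Ioo 0 T)
    (hC : ∀ t ∈ Ioc 0 τ, ∫ x in K, ‖f (x, t)‖ ∂μ ≤ C / t ^ N) :
    ∃ (A : ℝ) (m : ℕ), 0 ≤ A ∧ ∀ φ : E → ℝ, ContDiff ℝ ∞ φ → ∀ M : ℝ, 0 ≤ M →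
      (∀ k ≤ m, ∀ x, ‖iteratedFDeriv ℝ k φ x‖ ≤ M) →
        ‖taylorTrace μ K f τ N fun j => (evolve e b)^[j] fun p => (φ p.1 : ℂ)‖ ≤ A * M := by
  obtain ⟨A, hA0, hA⟩ := exists_norm_taylorTrace_le hf hK hKU hτ hC
  have key : ∀ j, ∃ (B : ℝ) (m : ℕ), 0 ≤ B ∧ ∀ φ : E → ℝ, ContDiff ℝ ∞ φ → ∀ M : ℝ,
      (∀ k ≤ m, ∀ x, ‖iteratedFDeriv ℝ k φ x‖ ≤ M) → ∀ p ∈ K ×ˢ Icc 0 τ,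
        ‖(evolve e b)^[j] (fun p => (φ p.1 : ℂ)) p‖ ≤ B * M := by
    intro j
    -- No vanishing of the coefficients is used here: the set `S` may be empty.
    obtain ⟨Q, hQ, h⟩ := IsTangentialOp.exists_iterate_evolve (e := e) (S := ∅) (T := T) hb
      (by simp) j
    obtain ⟨B, m, hB0, hB⟩ := hQ.exists_bound_of_isCompact (hK.prod isCompact_Icc)
    exact ⟨B, m, hB0, fun φ hφ M hM p hp => by rw [h φ hφ]; exact hB φ hφ M hM p hp⟩
  choose B m hB0 hB using key
  have hle : ∀ j ≤ N + 1, B j ≤ ∑ i ∈ Finset.range (N + 2), B i := fun j hj =>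
    Finset.single_le_sum (f := B) (fun i _ => hB0 i) (Finset.mem_range.2 (by omega))
  have hS0 : 0 ≤ ∑ i ∈ Finset.range (N + 2), B i := Finset.sum_nonneg fun i _ => hB0 i
  refine ⟨A * ∑ i ∈ Finset.range (N + 2), B i, (Finset.range (N + 2)).sup m, by positivity,
    fun φ hφ M hM0 hM => ?_⟩
  rw [mul_assoc]
  refine hA _ _ (by positivity) fun j hj x hx t ht => ?_
  refine (hB j φ hφ M (fun k hk => hM k (hk.trans ?_)) (x, t) ⟨hx, ht.1.le, ht.2⟩).trans ?_
  · exact Finset.le_sup (f := m) (Finset.mem_range.2 (by omega))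
  · exact mul_le_mul_of_nonneg_right (hle j hj) hM0

/-- If the coefficients vanish on `S × (0, T)`, then the Taylor formula for the cutoff functions of
`S` concentrates on `S`: the powers of the evolution operator applied to the cutoffs are uniformly
bounded, tend to zero off `S` by locality, and vanish almost everywhere on `S`. -/
theorem exists_cutoff_tendsto_taylorTrace (hf : ContinuousOn f (U ×ˢ Ioo 0 T)) (hU : IsOpen U)
    (hK : IsCompact K) (hKU : K ⊆ U) {S : Set E} (hS : IsCompact S) {r : ℝ} (hr : 0 < r)
    (hSK : Metric.cthickening r S ⊆ K) (hb : ∀ i, ContDiff ℝ ∞ (b i))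
    (hbS : ∀ i, ∀ x ∈ S, ∀ t ∈ Ioo 0 T, b i (x, t) = 0) :
    ∃ (ψ : ℕ → E → ℝ) (A : ℝ), (∀ m, ContDiff ℝ ∞ (ψ m)) ∧ (∀ m, tsupport (ψ m) ⊆ K) ∧
      (∀ m x, |ψ m x| ≤ A) ∧
      (∀ x, Tendsto (fun m => ψ m x) atTop (𝓝 (S.indicator (fun _ => 1) x))) ∧
      ∀ {τ C : ℝ} {N : ℕ}, τ ∈ Ioo 0 T →
        (∀ t ∈ Ioc 0 τ, ∫ x in K, ‖f (x, t)‖ ∂μ ≤ C / t ^ N) →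
        Tendsto (fun m => taylorTrace μ K f τ N fun j => (evolve e b)^[j] fun p => (ψ m p.1 : ℂ))
          atTop (𝓝 (∫ x in S, f (x, τ) ∂μ)) := by
  obtain ⟨A, hA⟩ := exists_cutoff hS e
  set ε : ℕ → ℝ := fun m => r * (1 / (m + 1 : ℝ)) with hε
  have hε0 : ∀ m, 0 < ε m := fun m => by positivity
  have hεr : ∀ m, ε m ≤ r := fun m => mul_le_of_le_one_right hr.le
    (div_le_one_of_le₀ (by linarith [(Nat.cast_nonneg m : (0 : ℝ) ≤ m)]) (by positivity))
  have hεlim : Tendsto ε atTop (𝓝 0) := by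
    simpa [hε] using tendsto_one_div_add_atTop_nhds_zero_nat.const_mul r
  choose ψ hψd hψ1 hψs hψA using fun m => hA (ε m) (hε0 m)
  have hψK : ∀ m, tsupport (ψ m) ⊆ K := fun m =>
    (hψs m).trans ((Metric.cthickening_mono (hεr m) S).trans hSK)
  have hSK' : S ⊆ K := (Metric.self_subset_cthickening S).trans hSK
  have hψb : ∀ m x, |ψ m x| ≤ A [] := fun m x => by simpa [iteratedPartial] using hψA m [] x
  have hoff : ∀ x ∉ S, ∀ᶠ m in atTop, ψ m =ᶠ[𝓝 x] 0 := by
    intro x hx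
    rw [← hS.isClosed.closure_eq, Metric.mem_closure_iff_infEDist_zero, ← ne_eq,
      ← pos_iff_ne_zero] at hx
    have h1 : Tendsto (fun m => ENNReal.ofReal (ε m)) atTop (𝓝 0) := by
      simpa using ENNReal.tendsto_ofReal hεlim
    filter_upwards [h1.eventually_lt_const hx] with m hm
    refine notMem_tsupport_iff_eventuallyEq.1 fun h => ?_
    exact (Metric.mem_cthickening_iff.1 (hψs m h)).not_gt hm
  have hψlim : ∀ x, Tendsto (fun m => ψ m x) atTop (𝓝 (S.indicator (fun _ => 1) x)) := by
    intro x
    by_cases hx : x ∈ S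
    · rw [indicator_of_mem hx]
      exact tendsto_const_nhds.congr fun m => ((hψ1 m x hx).self_of_nhds).symm
    · rw [indicator_of_notMem hx]
      refine tendsto_const_nhds.congr' ?_
      filter_upwards [hoff x hx] with m hm using hm.eq_of_nhds.symm
  refine ⟨ψ, A [], hψd, hψK, hψb, hψlim, fun {τ C N} hτ hC => ?_⟩
  set u : ℕ → ℕ → E × ℝ → ℂ := fun m j => (evolve e b)^[j] fun p => (ψ m p.1 : ℂ) with hu
  have hψd' : ∀ m, ContDiff ℝ ∞ fun p : E × ℝ => (ψ m p.1 : ℂ) := fun m =>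
    Complex.ofRealCLM.contDiff.comp ((hψd m).comp contDiff_fst)
  have hzero : ∀ m j (p : E × ℝ), ψ m =ᶠ[𝓝 p.1] 0 → u m j p = 0 := by
    intro m j p hp
    have h1 : (fun p : E × ℝ => (ψ m p.1 : ℂ)) =ᶠ[𝓝 p] 0 := by
      filter_upwards [continuous_fst.continuousAt.eventually hp] with q hq
      simp [hq]
    have h2 := (iterate_evolve_congr (e := e) (b := b) h1 j).eq_of_nhds
    rwa [iterate_evolve_zero] at h2
  have hu0 : ∀ m j, ∀ p : E × ℝ, p.1 ∉ K → u m j p = 0 := fun m j p hp =>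
    hzero m j p (notMem_tsupport_iff_eventuallyEq.1 fun h => hp (hψK m h))
  obtain ⟨R, hR⟩ := hK.isBounded.exists_norm_le
  have hbd : ∀ j, ∃ M, ∀ m, ∀ x ∈ K, ∀ t ∈ Ioo 0 T, ‖u m j (x, t)‖ ≤ M := by
    intro j
    obtain ⟨Q, hQ, h⟩ := IsTangentialOp.exists_iterate_evolve (e := e) hb hbS j
    obtain ⟨M, hM⟩ := hQ.exists_bound R A
    refine ⟨max M 0, fun m x hx t ht => ?_⟩
    by_cases hxs : x ∈ tsupport (ψ m)
    · have h1 := hψs m hxs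
      rw [hS.cthickening_eq_biUnion_closedBall (hε0 m).le] at h1
      simp only [mem_iUnion] at h1
      obtain ⟨y, hy, hxy⟩ := h1
      rw [mem_closedBall_iff_norm] at hxy
      rw [hu]
      simp only [h (ψ m) (hψd m)]
      exact (hM (ψ m) (ε m) (hε0 m) (hψA m) x y (hR x hx) (hR y (hSK' hy)) hy hxy t ht).trans
        (le_max_left _ _)
    · rw [hzero m j (x, t) (notMem_tsupport_iff_eventuallyEq.1 hxs), norm_zero]
      exact le_max_right _ _
  choose M hM using hbd
  have hMle : ∀ j ≤ N + 1, M j ≤ ∑ i ∈ Finset.range (N + 2), |M i| := fun j hj =>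
    (le_abs_self _).trans (Finset.single_le_sum (f := fun i => |M i|) (fun i _ => abs_nonneg _)
      (Finset.mem_range.2 (by omega)))
  have hmain := tendsto_taylorTrace (μ := μ) (u := u) (v := S.indicator fun _ => 1)
    (M := ∑ i ∈ Finset.range (N + 2), |M i|) hf hK hU hKU hτ hC
    (Finset.sum_nonneg fun i _ => abs_nonneg _)
    (fun m j => (contDiff_iterate_evolve hb (hψd' m) j).continuous) hu0
    (fun m j hj x hx t ht => (hM j m x hx t ⟨ht.1, ht.2.trans_lt hτ.2⟩).trans (hMle j hj))
    (Eventually.of_forall fun x => ?_) (fun j => ?_)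
  · have h1 : ∀ x, S.indicator (fun _ => (1 : ℂ)) x * f (x, τ)
        = S.indicator (fun x => f (x, τ)) x := fun x => by
      by_cases hx : x ∈ S <;> simp [hx]
    simp only [h1] at hmain
    rwa [setIntegral_indicator hS.measurableSet, inter_eq_self_of_subset_right hSK'] at hmain
  · have h1 := (Complex.continuous_ofReal.tendsto _).comp (hψlim x)
    have h2 : ((S.indicator (fun _ => (1 : ℝ)) x : ℝ) : ℂ) = S.indicator (fun _ => (1 : ℂ)) x := by
      by_cases hx : x ∈ S <;> simp [hx]
    rwa [h2] at h1
  · have h1 := (ae_restrict_iff' hS.measurableSet).1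
      (ae_iterate_evolve_one_eq_zero (e := e) μ hS.measurableSet hb hbS j)
    refine ae_restrict_of_ae ?_
    filter_upwards [h1] with x hx t ht
    refine tendsto_const_nhds.congr' ?_
    by_cases hxS : x ∈ S
    · refine Eventually.of_forall fun m => ?_
      have h2 : (fun p : E × ℝ => (ψ m p.1 : ℂ)) =ᶠ[𝓝 (x, t)] fun _ => 1 := by
        filter_upwards [continuous_fst.continuousAt.eventually (hψ1 m x hxS)] with q hq
        simp [hq]
      rw [hu]
      simp only [(iterate_evolve_congr (e := e) (b := b) h2 (j + 1)).eq_of_nhds]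
      exact (hx hxS t ⟨ht.1, ht.2.trans_lt hτ.2⟩).symm
    · filter_upwards [hoff x hxS] with m hm using (hzero m (j + 1) (x, t) hm).symm

end Pairing

/-! ### The trace distribution -/

section Extension

variable {E : Type*} [NormedAddCommGroup E] [NormedSpace ℝ E] [FiniteDimensional ℝ E] {ι : Type*}

/-- Smooth coefficients on `U × (-T, T)` can be replaced by globally smooth ones, unchanged near
`K × [0, T']` and vanishing wherever the old ones vanish. -/
theorem exists_global_coefficients {U K : Set E} (hU : IsOpen U) (hK : IsCompact K) (hKU : K ⊆ U)
    {T T' : ℝ} (hT : 0 < T) (hT' : T' < T) {b : ι → E × ℝ → ℂ}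
    (hb : ∀ i, ContDiffOn ℝ ∞ (b i) (U ×ˢ Ioo (-T) T)) :
    ∃ b' : ι → E × ℝ → ℂ, (∀ i, ContDiff ℝ ∞ (b' i)) ∧
      (∀ i, ∀ p ∈ K ×ˢ Icc 0 T', b i =ᶠ[𝓝 p] b' i) ∧ ∀ i p, b i p = 0 → b' i p = 0 := by
  have hQ : IsCompact (K ×ˢ Icc 0 T') := hK.prod isCompact_Icc
  have hO : IsOpen (U ×ˢ Ioo (-T) T) := hU.prod isOpen_Ioo
  have hQO : K ×ˢ Icc 0 T' ⊆ U ×ˢ Ioo (-T) T :=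
    prod_mono hKU fun t ht => ⟨by linarith [ht.1], ht.2.trans_lt hT'⟩
  obtain ⟨ε, hε, hεO⟩ := hQ.exists_cthickening_subset_open hO hQO
  -- Only the cutoff itself is needed, so the directions of differentiation are an empty family.
  obtain ⟨A, hA⟩ := exists_cutoff hQ (Empty.elim : Empty → E × ℝ)
  obtain ⟨χ, hχ, hχ1, hχs, -⟩ := hA ε hε
  refine ⟨fun i p => (χ p : ℂ) * b i p, fun i => ?_, fun i p hp => ?_, fun i p h => by
    simp [h]⟩
  · rw [contDiff_iff_contDiffAt]
    intro p
    by_cases hp : p ∈ tsupport χ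
    · exact (Complex.ofRealCLM.contDiff.comp hχ).contDiffAt.mul
        ((hb i).contDiffAt (hO.mem_nhds (hεO (hχs hp))))
    · refine (contDiffAt_const (c := (0 : ℂ))).congr_of_eventuallyEq ?_
      filter_upwards [notMem_tsupport_iff_eventuallyEq.1 hp] with q hq
      simp [hq]
  · filter_upwards [hχ1 p hp] with q hq
    rw [hq, Complex.ofReal_one, one_mul]

end Extension

variable {n : ℕ} {a T : ℝ} {b : Fin n → EuclideanSpace ℝ (Fin n) × ℝ → ℂ}
  {f : EuclideanSpace ℝ (Fin n) × ℝ → ℂ}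

theorem transposeField_eq_neg_evolve (b : Fin n → EuclideanSpace ℝ (Fin n) × ℝ → ℂ)
    (Φ : EuclideanSpace ℝ (Fin n) × ℝ → ℂ) (p : EuclideanSpace ℝ (Fin n) × ℝ) :
    transposeField b Φ p = -evolve (fun j => EuclideanSpace.single j (1 : ℝ)) b Φ p := by
  rw [transposeField, evolve]
  ring

theorem IsWeakSolution.solvesOn (hLf : IsWeakSolution b a T f)
    {K : Set (EuclideanSpace ℝ (Fin n))} (hK : IsCompact K) (hKU : K ⊆ Metric.ball 0 a) {T' : ℝ}
    (hT' : T' < T) {b' : Fin n → EuclideanSpace ℝ (Fin n) × ℝ → ℂ}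
    (hbb : ∀ i, ∀ p ∈ K ×ˢ Icc 0 T', b i =ᶠ[𝓝 p] b' i) :
    SolvesOn volume (fun j => EuclideanSpace.single j (1 : ℝ)) b' (Metric.ball 0 a) K T T' f := by
  intro u hu hu0 η hη hηc hηs
  set Φ : EuclideanSpace ℝ (Fin n) × ℝ → ℂ := fun q => (η q.2 : ℂ) * u q with hΦ
  have hsupp : tsupport Φ ⊆ K ×ˢ tsupport η := by
    refine closure_minimal (fun p hp => ?_) (hK.isClosed.prod (isClosed_tsupport η))
    refine ⟨?_, subset_tsupport η ?_⟩
    · by_contra h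
      exact hp (by simp [hΦ, hu0 p h])
    · intro h
      exact hp (by simp [hΦ, h])
  have hsub : K ×ˢ tsupport η ⊆ K ×ˢ Icc 0 T' :=
    prod_mono_right fun t ht => Ioo_subset_Icc_self (hηs ht)
  have hsubU : K ×ˢ tsupport η ⊆ Metric.ball 0 a ×ˢ Ioo 0 T :=
    prod_mono hKU (hηs.trans (Ioo_subset_Ioo_right hT'.le))
  let Ψ : 𝓓(halfCylinder n a T, ℂ) :=
    { toFun := Φ
      contDiff' := (Complex.ofRealCLM.contDiff.comp (hη.comp contDiff_snd)).mul hu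
      hasCompactSupport' :=
        HasCompactSupport.of_support_subset_isCompact (hK.prod hηc.isCompact)
          (subset_closure.trans hsupp)
      tsupport_subset' := hsupp.trans hsubU }
  have h1 := hLf Ψ
  have h2 : ∀ p, f p * transposeField b Ψ p
      = -(f p * evolve (fun j => EuclideanSpace.single j (1 : ℝ)) b' Φ p) := by
    intro p
    change f p * transposeField b Φ p = _
    rw [transposeField_eq_neg_evolve, mul_neg]
    congr 2
    by_cases hp : p ∈ tsupport Φ
    · exact (evolve_congr .rfl fun i => hbb i p (hsub (hsupp hp))).eq_of_nhds
    · have h3 : Φ =ᶠ[𝓝 p] 0 := notMem_tsupport_iff_eventuallyEq.1 hp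
      rw [(evolve_congr h3 fun i => .rfl).eq_of_nhds, (evolve_congr h3 fun i => .rfl).eq_of_nhds,
        evolve_zero, evolve_zero]
  simp only [h2, integral_neg, neg_eq_zero] at h1
  exact h1

/-- The data which the hypotheses provide near `K × [0, τ]`: globally smooth coefficients, the
equation they satisfy, and the growth bound. -/
theorem exists_local_data (hb : ∀ j, ContDiffOn ℝ ∞ (b j) (Metric.ball 0 a ×ˢ Ioo (-T) T))
    (hf : ContinuousOn f (Metric.ball 0 a ×ˢ Ioo 0 T)) (hLf : IsWeakSolution b a T f)
    (hgrowth : HasTemperedL1Growth a f) {K : Set (EuclideanSpace ℝ (Fin n))} (hK : IsCompact K)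
    (hKU : K ⊆ Metric.ball 0 a) {τ : ℝ} (hτ : τ ∈ Ioo 0 T) :
    ∃ (T' : ℝ) (b' : Fin n → EuclideanSpace ℝ (Fin n) × ℝ → ℂ) (N : ℕ) (C : ℝ),
      τ < T' ∧ T' ≤ T ∧ (∀ i, ContDiff ℝ ∞ (b' i)) ∧ (∀ i p, b i p = 0 → b' i p = 0) ∧
      SolvesOn volume (fun j => EuclideanSpace.single j (1 : ℝ)) b' (Metric.ball 0 a) K T T' f ∧
      ∀ t ∈ Ioc 0 τ, ∫ x in K, ‖f (x, t)‖ ≤ C / t ^ N := by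
  obtain ⟨T', hT', hT'T⟩ := exists_between hτ.2
  obtain ⟨b', hb', hbb, hb0⟩ := exists_global_coefficients Metric.isOpen_ball hK hKU
    (hτ.1.trans hτ.2) hT'T hb
  obtain ⟨N, C, -, hC⟩ := hgrowth K hK hKU
  obtain ⟨C', -, hC'⟩ := exists_growth_bound hf hK hKU hC hτ
  exact ⟨T', b', N, C', hT', hT'T.le, hb', hb0, hLf.solvesOn hK hKU hT'T hbb, hC'⟩

theorem integral_smul_eq_pairing {K U : Set (EuclideanSpace ℝ (Fin n))} (hKU : K ⊆ U)
    {φ : EuclideanSpace ℝ (Fin n) → ℝ} (hφ : ∀ x ∉ K, φ x = 0)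
    (f : EuclideanSpace ℝ (Fin n) × ℝ → ℂ) (t : ℝ) :
    ∫ x in U, φ x • f (x, t) = pairing volume K f (fun p => (φ p.1 : ℂ)) t := by
  have h0 : ∀ x, x ∉ K → φ x • f (x, t) = 0 := fun x hx => by rw [hφ x hx, zero_smul]
  rw [setIntegral_eq_integral_of_forall_compl_eq_zero fun x hx => h0 x fun h => hx (hKU h),
    ← setIntegral_eq_integral_of_forall_compl_eq_zero h0]
  simp only [pairing, Complex.real_smul]

/-- The trace of a weak solution with tempered growth, constructed as a distribution. On functions
supported in `K` it is given by Taylor's formula, which shows that it has finite order there. -/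
theorem exists_isTrace (hT : 0 < T)
    (hb : ∀ j, ContDiffOn ℝ ∞ (b j) (Metric.ball 0 a ×ˢ Ioo (-T) T))
    (hf : ContinuousOn f (Metric.ball 0 a ×ˢ Ioo 0 T)) (hLf : IsWeakSolution b a T f)
    (hgrowth : HasTemperedL1Growth a f) : ∃ bf : 𝓓'(ballOpens n a, ℂ), IsTrace f bf := by
  obtain ⟨τ, hτ⟩ := exists_between hT
  have main : ∀ K : Set (EuclideanSpace ℝ (Fin n)), IsCompact K → K ⊆ Metric.ball 0 a →
      ∃ (A : ℝ) (m : ℕ), 0 ≤ A ∧ ∀ φ : EuclideanSpace ℝ (Fin n) → ℝ, ContDiff ℝ ∞ φ →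
        (∀ x ∉ K, φ x = 0) → ∃ l : ℂ,
          Tendsto (fun t : ℝ => ∫ x in Metric.ball 0 a, φ x • f (x, t)) (𝓝[>] 0) (𝓝 l) ∧
          ∀ M : ℝ, 0 ≤ M → (∀ k ≤ m, ∀ x, ‖iteratedFDeriv ℝ k φ x‖ ≤ M) → ‖l‖ ≤ A * M := by
    intro K hK hKU
    obtain ⟨T', b', N, C, hτT', hT'T, hb', -, hsol, hC⟩ :=
      exists_local_data hb hf hLf hgrowth hK hKU hτ
    obtain ⟨A, m, hA0, hA⟩ := exists_norm_taylorTrace_iterate_le (μ := volume)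
      (e := fun j => EuclideanSpace.single j (1 : ℝ)) hf hK hKU hb' hτ hC
    refine ⟨A, m, hA0, fun φ hφ hφK => ⟨_, ?_, hA φ hφ⟩⟩
    simp only [integral_smul_eq_pairing hKU hφK]
    exact hsol.tendsto_pairing hT'T hf Metric.isOpen_ball hK hKU hb' ⟨hτ.1, hτT'⟩ hC
      (Complex.ofRealCLM.contDiff.comp (hφ.comp contDiff_fst))
      fun p hp => by rw [hφK p.1 hp, Complex.ofReal_zero]
  have hlim : ∀ φ : 𝓓(ballOpens n a, ℝ), ∃ l : ℂ,
      Tendsto (fun t : ℝ => ∫ x in Metric.ball 0 a, φ x • f (x, t)) (𝓝[>] 0) (𝓝 l) := by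
    intro φ
    obtain ⟨A, m, -, h⟩ := main (tsupport φ) φ.hasCompactSupport φ.tsupport_subset
    obtain ⟨l, hl, -⟩ := h φ φ.contDiff fun x hx => image_eq_zero_of_notMem_tsupport hx
    exact ⟨l, hl⟩
  choose L hL using hlim
  have hint : ∀ φ : 𝓓(ballOpens n a, ℝ), ∀ᶠ t in 𝓝[>] (0 : ℝ),
      IntegrableOn (fun x => φ x • f (x, t)) (Metric.ball 0 a) := by
    intro φ
    filter_upwards [Ioo_mem_nhdsGT hT] with t ht
    have h1 : IntegrableOn (fun x => φ x • f (x, t)) (tsupport φ) :=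
      (φ.contDiff.continuous.continuousOn.smul (continuousOn_slice hf φ.tsupport_subset
        ht)).integrableOn_compact φ.hasCompactSupport
    exact (integrableOn_iff_integrable_of_support_subset fun x hx =>
      subset_tsupport φ fun h => hx (by simp [h])).1 h1 |>.integrableOn
  have hadd : ∀ φ ψ, L (φ + ψ) = L φ + L ψ := by
    intro φ ψ
    refine tendsto_nhds_unique (hL (φ + ψ)) (((hL φ).add (hL ψ)).congr' ?_)
    filter_upwards [hint φ, hint ψ] with t h1 h2
    rw [← integral_add h1 h2]
    exact integral_congr_ae (Eventually.of_forall fun x => by simp [add_smul])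
  have hsmul : ∀ (c : ℝ) φ, L (c • φ) = c • L φ := by
    intro c φ
    refine tendsto_nhds_unique (hL (c • φ)) (((hL φ).const_smul c).congr' ?_)
    filter_upwards with t
    rw [← integral_smul]
    exact integral_congr_ae (Eventually.of_forall fun x => by simp [mul_assoc])
  refine ⟨TestFunction.limitCLM ℝ L (fun K hK => ContDiffMapSupportedIn.mkCLMtoNormedSpace ℝ
    (fun φ => L (TestFunction.ofSupportedIn hK φ)) 
    (fun φ ψ => hadd (TestFunction.ofSupportedIn hK φ) (TestFunction.ofSupportedIn hK ψ))
    (fun c φ => hsmul c (TestFunction.ofSupportedIn hK φ)) ?_)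
    fun K hK φ => rfl, fun φ => hL φ⟩
  obtain ⟨A, m, hA0, h⟩ := main K K.isCompact hK
  refine ⟨Finset.range (m + 1), A, hA0, fun φ => ?_⟩
  obtain ⟨l, hl, hl'⟩ := h φ φ.contDiff fun x hx => φ.zero_on_compl hx
  have hLl : L (TestFunction.ofSupportedIn hK φ) = l := tendsto_nhds_unique (hL _) hl
  rw [hLl]
  refine hl' _ (apply_nonneg _ _) fun k hk x => ?_
  refine (ContDiffMapSupportedIn.norm_iteratedFDeriv_apply_le_seminorm_top ℝ (i := k)).trans ?_
  exact Seminorm.le_finset_sup_apply (Finset.mem_range.2 (by omega))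

/-- When the trace is an integrable function `g`, it has the same integral over every compact
`S ⊆ F` as `f(·, τ)`. -/
theorem setIntegral_eq_of_isTrace
    (hb : ∀ j, ContDiffOn ℝ ∞ (b j) (Metric.ball 0 a ×ˢ Ioo (-T) T))
    (hf : ContinuousOn f (Metric.ball 0 a ×ˢ Ioo 0 T)) (hLf : IsWeakSolution b a T f)
    (hgrowth : HasTemperedL1Growth a f) {S : Set (EuclideanSpace ℝ (Fin n))} (hS : IsCompact S)
    (hSU : S ⊆ Metric.ball 0 a) (hbS : ∀ j, ∀ x ∈ S, ∀ t ∈ Ioo 0 T, b j (x, t) = 0)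
    {bf : 𝓓'(ballOpens n a, ℂ)} (hbf : IsTrace f bf) {g : EuclideanSpace ℝ (Fin n) → ℂ}
    (hg : IsL1Function bf g) {τ : ℝ} (hτ : τ ∈ Ioo 0 T) :
    ∫ x in S, f (x, τ) = ∫ x in S, g x := by
  obtain ⟨r, hr, hrU⟩ := hS.exists_cthickening_subset_open Metric.isOpen_ball hSU
  set K := Metric.cthickening r S with hK'
  have hK : IsCompact K := hS.cthickening
  obtain ⟨T', b', N, C, hτT', hT'T, hb', hb0, hsol, hC⟩ :=
    exists_local_data hb hf hLf hgrowth hK hrU hτ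
  obtain ⟨ψ, A, hψd, hψK, hψA, hψlim, hψ⟩ := exists_cutoff_tendsto_taylorTrace (μ := volume)
    (e := fun j => EuclideanSpace.single j (1 : ℝ)) hf Metric.isOpen_ball hK hrU hS hr le_rfl hb'
    fun i x hx t ht => hb0 i _ (hbS i x hx t ht)
  have h1 := hψ hτ hC
  let Ψ : ℕ → 𝓓(ballOpens n a, ℝ) := fun m =>
    { toFun := ψ m
      contDiff' := hψd m
      hasCompactSupport' := HasCompactSupport.of_support_subset_isCompact hK
        (subset_closure.trans (hψK m))
      tsupport_subset' := (hψK m).trans hrU }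
  have hψ0 : ∀ m, ∀ x ∉ K, ψ m x = 0 := fun m x hx =>
    image_eq_zero_of_notMem_tsupport fun h => hx (hψK m h)
  have h2 : ∀ m, ∫ x in Metric.ball 0 a, ψ m x • g x
      = taylorTrace volume K f τ N fun j =>
        (evolve (fun j => EuclideanSpace.single j (1 : ℝ)) b')^[j] fun p => (ψ m p.1 : ℂ) := by
    intro m
    have h3 : bf (Ψ m) = ∫ x in Metric.ball 0 a, ψ m x • g x := hg.2 (Ψ m)
    have h4 : Tendsto (fun t : ℝ => ∫ x in Metric.ball 0 a, ψ m x • f (x, t)) (𝓝[>] 0)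
      (𝓝 (bf (Ψ m))) := hbf (Ψ m)
    rw [← h3]
    refine tendsto_nhds_unique h4 ?_
    simp only [integral_smul_eq_pairing hrU (hψ0 m)]
    exact hsol.tendsto_pairing hT'T hf Metric.isOpen_ball hK hrU hb' ⟨hτ.1, hτT'⟩ hC
      (Complex.ofRealCLM.contDiff.comp ((hψd m).comp contDiff_fst))
      fun p hp => by rw [hψ0 m p.1 hp, Complex.ofReal_zero]
  have h5 : Tendsto (fun m => ∫ x in Metric.ball 0 a, ψ m x • g x) atTop
      (𝓝 (∫ x in Metric.ball 0 a, S.indicator g x)) := by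
    refine tendsto_integral_of_dominated_convergence (fun x => A * ‖g x‖) (fun m => ?_)
      (hg.1.norm.const_mul A) (fun m => Eventually.of_forall fun x => ?_)
      (Eventually.of_forall fun x => ?_)
    · exact (hψd m).continuous.aestronglyMeasurable.smul hg.1.aestronglyMeasurable
    · rw [norm_smul]
      exact mul_le_mul_of_nonneg_right (hψA m x) (norm_nonneg _)
    · have h6 := (hψlim x).smul_const (g x)
      by_cases hx : x ∈ S
      · simpa [hx] using h6
      · simpa [hx] using h6
  rw [setIntegral_indicator hS.measurableSet, inter_eq_self_of_subset_right hSU] at h5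
  simp only [h2] at h5
  exact tendsto_nhds_unique h1 h5

theorem ae_eq_of_forall_isCompact_setIntegral_eq {X : Type*} [TopologicalSpace X]
    [MeasurableSpace X] [BorelSpace X] [T2Space X] [SigmaCompactSpace X] {μ : Measure X}
    {F : Set X} (hF : IsCompact F) {u v : X → ℂ} (hu : IntegrableOn u F μ) (hv : IntegrableOn v F μ)
    (h : ∀ S ⊆ F, IsCompact S → ∫ x in S, u x ∂μ = ∫ x in S, v x ∂μ) :
    ∀ᵐ x ∂μ.restrict F, u x = v x := by
  have h1 : (fun x => u x - v x) =ᵐ[μ.restrict F] 0 := by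
    refine ae_eq_zero_of_forall_setIntegral_isCompact_eq_zero (hu.sub hv) fun s hs => ?_
    have hsF : IsCompact (s ∩ F) := hs.inter hF
    rw [Measure.restrict_restrict hs.measurableSet, integral_sub
      (hu.mono_set inter_subset_right) (hv.mono_set inter_subset_right),
      h _ inter_subset_right hsF, sub_self]
  filter_upwards [h1] with x hx using sub_eq_zero.1 hx

end VectorFieldTrace

theorem lemma2p2 (n : ℕ) (a T : ℝ) (ha : 0 < a) (hT : 0 < T)
    (b : Fin n → EuclideanSpace ℝ (Fin n) × ℝ → ℂ)
    (hb : ∀ j, ContDiffOn ℝ ∞ (b j) (Metric.ball 0 a ×ˢ Ioo (-T) T))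
    (F : Set (EuclideanSpace ℝ (Fin n))) (hF : F ⊆ Metric.ball 0 a)
    (hFclosed : IsClosed ((↑) ⁻¹' F : Set (Metric.ball (0 : EuclideanSpace ℝ (Fin n)) a)))
    (hbF : ∀ j, ∀ x ∈ F, ∀ t ∈ Ico 0 T, b j (x, t) = 0)
    (f : EuclideanSpace ℝ (Fin n) × ℝ → ℂ)
    (hf : ContinuousOn f (Metric.ball 0 a ×ˢ Ioo 0 T))
    (hLf : IsWeakSolution b a T f)
    (hgrowth : HasTemperedL1Growth a f) :
    ∃ bf : 𝓓'(ballOpens n a, ℂ), IsTrace f bf ∧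
      ∀ g : EuclideanSpace ℝ (Fin n) → ℂ, IsL1Function bf g →
        ∀ᵐ x ∂(volume.restrict F),
          Tendsto (fun t : ℝ => f (x, t)) (𝓝[>] 0) (𝓝 (g x)) ∧
            ∀ t ∈ Ioo 0 T, f (x, t) = g x := by
  obtain ⟨bf, hbf⟩ := exists_isTrace hT hb hf hLf hgrowth
  refine ⟨bf, hbf, fun g hg => ?_⟩
  obtain ⟨Z, hZ, hZF⟩ := isClosed_induced_iff.1 hFclosed
  have hFZ : F = Metric.ball 0 a ∩ Z := by
    rw [Subtype.preimage_val_eq_preimage_val_iff, inter_eq_self_of_subset_right hF] at hZF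
    exact hZF.symm
  have hFm : MeasurableSet F := hFZ ▸ measurableSet_ball.inter hZ.measurableSet
  have hfix : ∀ τ ∈ Ioo 0 T, ∀ᵐ x ∂volume.restrict F, f (x, τ) = g x := by
    intro τ hτ
    -- Exhaust `F` by the compact sets `F ∩ closedBall 0 (a - 1 / (k + 1))`.
    have hcover : F = ⋃ k : ℕ, F ∩ Metric.closedBall 0 (a - 1 / (k + 1 : ℝ)) := by
      refine subset_antisymm (fun x hx => ?_) (iUnion_subset fun k => inter_subset_left)
      have hxa : ‖x‖ < a := by simpa using hF hx
      obtain ⟨k, hk⟩ := exists_nat_one_div_lt (sub_pos.2 hxa)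
      exact mem_iUnion.2 ⟨k, hx, by rw [mem_closedBall_zero_iff]; linarith⟩
    rw [hcover, ae_restrict_iUnion_iff]
    intro k
    have hsub : Metric.closedBall (0 : EuclideanSpace ℝ (Fin n)) (a - 1 / (k + 1 : ℝ))
        ⊆ Metric.ball 0 a :=
      Metric.closedBall_subset_ball (sub_lt_self _ Nat.one_div_pos_of_nat)
    have hcpt : IsCompact (F ∩ Metric.closedBall 0 (a - 1 / (k + 1 : ℝ))) := by
      have : F ∩ Metric.closedBall 0 (a - 1 / (k + 1 : ℝ))
          = Metric.closedBall 0 (a - 1 / (k + 1 : ℝ)) ∩ Z := by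
        ext x
        rw [hFZ]
        exact ⟨fun h => ⟨h.2, h.1.2⟩, fun h => ⟨⟨hsub h.1, h.2⟩, h.1⟩⟩
      rw [this]
      exact (isCompact_closedBall _ _).inter_right hZ
    refine ae_eq_of_forall_isCompact_setIntegral_eq hcpt
      (integrableOn_slice hf hcpt (inter_subset_left.trans hF) hτ)
      (hg.1.mono_set (inter_subset_left.trans hF)) fun S hS hSc => ?_
    have hSF : S ⊆ F := hS.trans inter_subset_left
    exact setIntegral_eq_of_isTrace hb hf hLf hgrowth hSc (hSF.trans hF)
      (fun j x hx t ht => hbF j x (hSF hx) t (Ioo_subset_Ico_self ht)) hbf hg hτ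
  have hrat : ∀ᵐ x ∂volume.restrict F, ∀ q : ℚ, (q : ℝ) ∈ Ioo 0 T → f (x, q) = g x := by
    rw [ae_all_iff]
    intro q
    by_cases hq : (q : ℝ) ∈ Ioo 0 T
    · filter_upwards [hfix q hq] with x hx _ using hx
    · exact Eventually.of_forall fun x h => absurd h hq
  filter_upwards [hrat, ae_restrict_mem hFm] with x hx hxF
  have hcont : ContinuousOn (fun t : ℝ => f (x, t)) (Ioo 0 T) :=
    hf.comp (by fun_prop) fun t ht => ⟨hF hxF, ht⟩
  have hall : ∀ t ∈ Ioo 0 T, f (x, t) = g x := by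
    intro t ht
    by_contra hne
    have h1 := (hcont.continuousAt (isOpen_Ioo.mem_nhds ht)).eventually_ne hne
    obtain ⟨V, hV, hVo, htV⟩ := mem_nhds_iff.1 (h1.and (Ioo_mem_nhds ht.1 ht.2))
    obtain ⟨q, hq⟩ := Rat.denseRange_cast.exists_mem_open hVo ⟨t, htV⟩
    exact (hV hq).1 (hx q (hV hq).2)
  refine ⟨tendsto_const_nhds.congr' ?_, hall⟩
  filter_upwards [Ioo_mem_nhdsGT hT] with t ht using (hall t ht).symm
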